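/- Let $\Gamma$ be a countable (discrete) group. A \emph{trace} on $\Gamma$ is a positive definite, conjugation-invariant function $\varphi:\Gamma\to\mathbb{C}$ with $\varphi(e)=1$; traces form a convex set $\mathrm{Tr}(\Gamma)$, with the topology of pointwise convergence, and its extreme points are the \emph{characters}, forming $\mathrm{Ch}(\Gamma)$. Let $\pi_\varphi$ denote the GNS representation of a trace $\varphi$, i.e. the unitary representation, unique up to equivalence, with a cyclic vector $v_\varphi$ such that $\varphi(\gamma)=\langle\pi_\varphi(\gamma)v_\varphi,v_\varphi\rangle$ for all $\gamma\in\Gamma$. The trace $\varphi$ is \emph{amenable} if $\pi_\varphi\otimes\pi_\varphi^*$ admits almost invariant vectors. A set $\mathcal{R}$ of equivalence classes of unitary representations of $\Gamma$ is \emph{hereditary} if: (1) $\rho\in\mathcal{R}$ and $\pi\le\rho$ imply $\pi\in\mathcal{R}$; (2) $\rho\in\mathcal{R}$ implies $\rho^*\in\mathcal{R}$; (3) if $\Pi$ is a unitary representation of $\Gamma\times\Gamma$ whose restriction to each of the two factors belongs to $\mathcal{R}$, then the restriction of $\Pi$ to the diagonal copy of $\Gamma$ belongs to $\mathcal{R}$;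 (4) $\rho\in\mathcal{R}$ implies $\rho\otimes\rho^*\in\mathcal{R}$. For a unitary representation $\pi$ let $\pi_0$ be its subrepresentation on the orthogonal complement of the invariant vectors. The group $\Gamma$ has \emph{property} $\mathrm{T}(\mathcal{R})$ if the trivial representation $1$ is an isolated point of the set $\{\pi_0:\pi\in\mathcal{R}\}\cup\{1\}$ in the Fell topology. Put $\mathrm{Ch}(\Gamma;\mathcal{R})=\{\varphi\in\mathrm{Ch}(\Gamma):\pi_\varphi\in\mathcal{R}\}$. \textbf{Theorem.} Let $\Gamma$ be a countable group, $N\lhd\Gamma$ a normal subgroup and $\mathcal{R}$ a hereditary set of equivalence classes of unitary representations of $\Gamma$. Assume that $\Gamma$ has property $\mathrm{T}(\mathcal{R})$ and that every character of $\Gamma$ is either amenable or vanishes outside $N$. Let $\varphi_n\in\mathrm{Ch}(\Gamma;\mathcal{R})$, $n\in\mathbb{N}$, be a sequence of pairwise distinct characters. Then every accumulation point of the sequence $(\varphi_n)$ in the topology of pointwise convergence is a character that vanishes outside $N$, and $$\lim_{n\to\infty}\varphi_n(\gamma)=0\qquad\text{for all }\gamma\in\Gamma\setminus N.$$ -/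

import Mathlib

open scoped TensorProduct Topology

universe u w

/-- A unitary representation of a group on a complex Hilbert space. -/
structure UnitaryRep (Γ : Type u) [Group Γ] where
  /-- The underlying space. -/
  H : Type w
  [normedAddCommGroup : NormedAddCommGroup H]
  [innerProductSpace : InnerProductSpace ℂ H]
  [completeSpace : CompleteSpace H]
  /-- The action by unitary operators. -/
  toHom : Γ →* (H ≃ₗᵢ[ℂ] H)

namespace UnitaryRep

attribute [instance] UnitaryRep.normedAddCommGroup UnitaryRep.innerProductSpace
  UnitaryRep.completeSpace

variable {Γ : Type u} [Group Γ]

/-- `σ` is (equivalent to) a subrepresentation of `π`. -/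
def IsSubrep (σ π : UnitaryRep.{u, w} Γ) : Prop :=
  ∃ V : σ.H →ₗᵢ[ℂ] π.H, ∀ (γ : Γ) (x : σ.H), V (σ.toHom γ x) = π.toHom γ (V x)

/-- Unitary equivalence. -/
def IsEquiv (σ π : UnitaryRep.{u, w} Γ) : Prop :=
  ∃ V : σ.H ≃ₗᵢ[ℂ] π.H, ∀ (γ : Γ) (x : σ.H), V (σ.toHom γ x) = π.toHom γ (V x)

/-- The one-dimensional trivial representation. -/
noncomputable def trivial (Γ : Type u) [Group Γ] : UnitaryRep.{u, w} Γ where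
  H := EuclideanSpace ℂ PUnit.{w + 1}
  toHom := 1

/-- Pull-back of a unitary representation along a group homomorphism. -/
def comp {Λ : Type u} [Group Λ] (π : UnitaryRep.{u, w} Γ) (f : Λ →* Γ) : UnitaryRep.{u, w} Λ where
  H := π.H
  toHom := π.toHom.comp f

/-- Restriction of a representation of `Γ × Γ` to the first factor. -/
def restrictLeft (P : UnitaryRep.{u, w} (Γ × Γ)) : UnitaryRep.{u, w} Γ :=
  P.comp (MonoidHom.inl Γ Γ)

/-- Restriction of a representation of `Γ × Γ` to the second factor. -/
def restrictRight (P : UnitaryRep.{u, w} (Γ × Γ)) : UnitaryRep.{u, w} Γ :=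
  P.comp (MonoidHom.inr Γ Γ)

/-- Restriction of a representation of `Γ × Γ` to the diagonal. -/
def restrictDiag (P : UnitaryRep.{u, w} (Γ × Γ)) : UnitaryRep.{u, w} Γ :=
  P.comp ((MonoidHom.id Γ).prod (MonoidHom.id Γ))

/-! ### The complement of the invariant vectors -/

/-- The subspace of invariant vectors. -/
def invariants (π : UnitaryRep.{u, w} Γ) : Submodule ℂ π.H where
  carrier := {x | ∀ γ, π.toHom γ x = x}
  add_mem' := fun {x y} hx hy γ => by rw [map_add, hx γ, hy γ]
  zero_mem' := fun γ => map_zero _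
  smul_mem' := fun c x hx γ => by rw [map_smul, hx γ]

theorem map_orthogonal_invariants (π : UnitaryRep.{u, w} Γ) (γ : Γ) :
    ∀ x ∈ (π.invariants)ᗮ, π.toHom γ x ∈ (π.invariants)ᗮ := by
  intro x hx
  rw [Submodule.mem_orthogonal] at hx ⊢
  intro y hy
  have h := hx y hy
  rw [← (π.toHom γ).inner_map_map y x, hy γ] at h
  exact h

/-- The operator `π(γ)` restricted to the orthogonal complement of the invariant vectors. -/
noncomputable def nontrivialPartAux (π : UnitaryRep.{u, w} Γ) (γ : Γ) :
    (π.invariants)ᗮ ≃ₗᵢ[ℂ] (π.invariants)ᗮ where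
  toFun x := ⟨π.toHom γ x, π.map_orthogonal_invariants γ x x.2⟩
  invFun x := ⟨π.toHom γ⁻¹ x, π.map_orthogonal_invariants γ⁻¹ x x.2⟩
  map_add' x y := by ext; simp
  map_smul' c x := by ext; simp
  left_inv x := by
    ext
    change (π.toHom γ⁻¹ * π.toHom γ) (x : π.H) = x
    rw [← map_mul]; simp
  right_inv x := by
    ext
    change (π.toHom γ * π.toHom γ⁻¹) (x : π.H) = x
    rw [← map_mul]; simp
  norm_map' x := (π.toHom γ).norm_map x

/-- The subrepresentation `π₀` of `π` on the orthogonal complement of the invariant vectors. -/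
noncomputable def nontrivialPart (π : UnitaryRep.{u, w} Γ) : UnitaryRep.{u, w} Γ where
  H := (π.invariants)ᗮ
  toHom :=
    { toFun := π.nontrivialPartAux
      map_one' := by
        ext x
        change π.toHom 1 (x : π.H) = x
        simp
      map_mul' := fun γ δ => by
        ext x
        change π.toHom (γ * δ) (x : π.H) = π.toHom γ (π.toHom δ (x : π.H))
        simp }

/-! ### The dual representation -/

/-- The Hilbert space structure on the dual `H*` of a Hilbert space, given by
`⟪⟪x, ·⟫, ⟪y, ·⟫⟫ = ⟪y, x⟫`. The norm is the operator norm. -/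
@[reducible] noncomputable def dualInnerProductSpace (H : Type w) [NormedAddCommGroup H]
    [InnerProductSpace ℂ H] [CompleteSpace H] : InnerProductSpace ℂ (StrongDual ℂ H) where
  inner f g := inner ℂ ((InnerProductSpace.toDual ℂ H).symm g) ((InnerProductSpace.toDual ℂ H).symm f)
  norm_sq_eq_re_inner f := by
    rw [inner_self_eq_norm_sq, LinearIsometryEquiv.norm_map]
  conj_inner_symm f g := inner_conj_symm _ _
  add_left f g h := by rw [map_add, inner_add_right]
  smul_left f g c := by
    rw [LinearIsometryEquiv.map_smulₛₗ, inner_smul_right]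

/-- The dual (contragredient) representation on the dual Hilbert space; see `dual_apply`. -/
noncomputable def dual (π : UnitaryRep.{u, w} Γ) : UnitaryRep.{u, w} Γ :=
  letI := dualInnerProductSpace π.H
  { H := StrongDual ℂ π.H
    toHom :=
      { toFun := fun γ => (InnerProductSpace.toDual ℂ π.H).symm.trans
          ((π.toHom γ).trans (InnerProductSpace.toDual ℂ π.H))
        map_one' := by
          ext f x
          simp
        map_mul' := fun γ δ => by
          ext f x
          simp } }

theorem dual_apply (π : UnitaryRep.{u, w} Γ) (γ : Γ) (f : StrongDual ℂ π.H) (x : π.H) :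
    (show StrongDual ℂ π.H from π.dual.toHom γ f) x = f (π.toHom γ⁻¹ x) := by
  change inner ℂ (π.toHom γ ((InnerProductSpace.toDual ℂ π.H).symm f)) x = _
  rw [← InnerProductSpace.toDual_symm_apply (y := f),
    ← (π.toHom γ).inner_map_map _ (π.toHom γ⁻¹ x)]
  change _ = inner ℂ _ ((π.toHom γ * π.toHom γ⁻¹) x)
  rw [← map_mul]
  simp

/-! ### Tensor products -/

/-- The unitary operator on the Hilbert space completion induced by a unitary operator. -/
noncomputable def completionMap {E : Type w} [NormedAddCommGroup E] [InnerProductSpace ℂ E]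
    (e : E ≃ₗᵢ[ℂ] E) : UniformSpace.Completion E ≃ₗᵢ[ℂ] UniformSpace.Completion E where
  toLinearEquiv := LinearEquiv.ofLinearMap
    ((e : E →L[ℂ] E).completion : UniformSpace.Completion E →ₗ[ℂ] UniformSpace.Completion E)
    ((e.symm : E →L[ℂ] E).completion : UniformSpace.Completion E →ₗ[ℂ] UniformSpace.Completion E)
    (by
      ext x
      change (e : E →L[ℂ] E).completion ((e.symm : E →L[ℂ] E).completion x) = x
      induction x using UniformSpace.Completion.induction_on with
      | hp => exact isClosed_eq (by fun_prop) continuous_id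
      | ih x => simp)
    (by
      ext x
      change (e.symm : E →L[ℂ] E).completion ((e : E →L[ℂ] E).completion x) = x
      induction x using UniformSpace.Completion.induction_on with
      | hp => exact isClosed_eq (by fun_prop) continuous_id
      | ih x => simp)
  norm_map' x := by
    change ‖(e : E →L[ℂ] E).completion x‖ = ‖x‖
    induction x using UniformSpace.Completion.induction_on with
    | hp => exact isClosed_eq (by fun_prop) continuous_norm
    | ih x => simp

theorem completionMap_coe {E : Type w} [NormedAddCommGroup E] [InnerProductSpace ℂ E]
    (e : E ≃ₗᵢ[ℂ] E) (x : E) : completionMap e (x : UniformSpace.Completion E) = (e x : E) := by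
  change (e : E →L[ℂ] E).completion x = _
  simp

theorem continuous_completionMap {E : Type w} [NormedAddCommGroup E] [InnerProductSpace ℂ E]
    (e : E ≃ₗᵢ[ℂ] E) : Continuous (completionMap e) := (completionMap e).continuous

/-- The (Hilbertian) tensor product `π ⊗ ρ`, acting on the Hilbert space completion of the
algebraic tensor product; see `tensor_apply`. -/
noncomputable def tensor (π ρ : UnitaryRep.{u, w} Γ) : UnitaryRep.{u, w} Γ where
  H := UniformSpace.Completion (π.H ⊗[ℂ] ρ.H)
  toHom :=
    { toFun := fun γ =>
        completionMap (TensorProduct.congrIsometry (π.toHom γ) (ρ.toHom γ))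
      map_one' := by
        ext x
        induction x using UniformSpace.Completion.induction_on with
        | hp => exact isClosed_eq (continuous_completionMap _) continuous_id
        | ih x =>
          rw [completionMap_coe]
          induction x using TensorProduct.induction_on with
          | zero => simp
          | tmul a b => simp; rfl
          | add a b ha hb =>
            rw [map_add, UniformSpace.Completion.coe_add, ha, hb, ← map_add,
              ← UniformSpace.Completion.coe_add]
      map_mul' := fun γ δ => by
        ext x
        change _ = completionMap _ (completionMap _ x)
        induction x using UniformSpace.Completion.induction_on with
        | hp =>
          exact isClosed_eq (continuous_completionMap _)
            ((continuous_completionMap _).comp (continuous_completionMap _))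
        | ih x =>
          rw [completionMap_coe, completionMap_coe, completionMap_coe]
          congr 1
          induction x using TensorProduct.induction_on with
          | zero => simp
          | tmul a b => simp; rfl
          | add a b ha hb => simp only [map_add, ha, hb] }

theorem tensor_apply (π ρ : UnitaryRep.{u, w} Γ) (γ : Γ) (x : π.H) (y : ρ.H) :
    (π.tensor ρ).toHom γ ((x ⊗ₜ[ℂ] y : π.H ⊗[ℂ] ρ.H) : UniformSpace.Completion (π.H ⊗[ℂ] ρ.H)) =
      ((π.toHom γ x ⊗ₜ[ℂ] ρ.toHom γ y : π.H ⊗[ℂ] ρ.H) :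
        UniformSpace.Completion (π.H ⊗[ℂ] ρ.H)) := by
  change completionMap _ _ = _
  rw [completionMap_coe]
  simp

/-! ### Almost invariant vectors and the Fell topology -/

/-- `π` admits almost invariant vectors. -/
def HasAlmostInvariantVectors (π : UnitaryRep.{u, w} Γ) : Prop :=
  ∀ (Q : Finset Γ) (ε : ℝ), 0 < ε → ∃ x : π.H, ‖x‖ = 1 ∧ ∀ γ ∈ Q, ‖π.toHom γ x - x‖ < ε

/-- The basic set `W(π; f₁, …, fₙ; Q, ε)` of the Fell topology, where
`fᵢ(γ) = ⟨π(γ) ξᵢ, ξᵢ⟩` are functions of positive type associated to `π`: all `ρ` such that each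
`fᵢ` is `ε`-close on `Q` to a finite sum of functions of positive type associated to `ρ`. -/
def fellNhd (π : UnitaryRep.{u, w} Γ) {n : ℕ} (ξ : Fin n → π.H) (Q : Finset Γ) (ε : ℝ) :
    Set (UnitaryRep.{u, w} Γ) :=
  {ρ | ∀ i, ∃ (m : ℕ) (η : Fin m → ρ.H), ∀ γ ∈ Q,
    ‖inner ℂ (ξ i) (π.toHom γ (ξ i)) - ∑ j, inner ℂ (η j) (ρ.toHom γ (η j))‖ < ε}

/-- The Fell topology. -/
@[reducible] def fellTopology (Γ : Type u) [Group Γ] : TopologicalSpace (UnitaryRep.{u, w} Γ) :=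
  TopologicalSpace.generateFrom
    {W | ∃ (π : UnitaryRep.{u, w} Γ) (n : ℕ) (ξ : Fin n → π.H) (Q : Finset Γ) (ε : ℝ),
      0 < ε ∧ W = fellNhd π ξ Q ε}

/-- Property `T(R)`: in the Fell topology, the trivial representation is an isolated point of
`{π₀ : π ∈ R} ∪ {1}`, a set of representations considered up to unitary equivalence. -/
def PropertyT (R : Set (UnitaryRep.{u, w} Γ)) : Prop :=
  ∃ U : Set (UnitaryRep.{u, w} Γ), IsOpen[fellTopology Γ] U ∧ trivial Γ ∈ U ∧
    ∀ σ ∈ U ∩ (nontrivialPart '' R ∪ {trivial Γ}), IsEquiv σ (trivial Γ)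

/-- A hereditary set of (equivalence classes of) unitary representations. Invariance under unitary
equivalence is contained in `mem_of_isSubrep`. -/
structure IsHereditary (R : Set (UnitaryRep.{u, w} Γ)) : Prop where
  /-- `R` is subrepresentation-closed. -/
  mem_of_isSubrep : ∀ π ρ : UnitaryRep.{u, w} Γ, ρ ∈ R → IsSubrep π ρ → π ∈ R
  /-- `R` is dual-closed. -/
  dual_mem : ∀ ρ ∈ R, ρ.dual ∈ R
  /-- `R` is diagonal-closed. -/
  restrictDiag_mem : ∀ P : UnitaryRep.{u, w} (Γ × Γ),
    P.restrictLeft ∈ R → P.restrictRight ∈ R → P.restrictDiag ∈ R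
  /-- `R` is closed under `ρ ↦ ρ ⊗ ρ*`, the diagonal restriction of the exterior tensor product of
  `ρ` and `ρ*`. This is not automatic from the other conditions, because the restrictions of the
  exterior tensor product to the two factors are multiples of `ρ` and `ρ*`. -/
  tensor_dual_mem : ∀ ρ ∈ R, ρ.tensor ρ.dual ∈ R

end UnitaryRep

/-! ### Traces and characters -/

section Traces

variable {Γ : Type u} [Group Γ]

/-- `φ` is positive definite. -/
def IsPositiveDefinite (φ : Γ → ℂ) : Prop :=
  ∀ (n : ℕ) (g : Fin n → Γ) (α : Fin n → ℂ),
    0 ≤ (∑ i, ∑ j, α i * (starRingEnd ℂ) (α j) * φ ((g j)⁻¹ * g i)).re ∧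
      (∑ i, ∑ j, α i * (starRingEnd ℂ) (α j) * φ ((g j)⁻¹ * g i)).im = 0

/-- The set of traces on `Γ`. -/
def traces (Γ : Type u) [Group Γ] : Set (Γ → ℂ) :=
  {φ | IsPositiveDefinite φ ∧ (∀ γ x, φ (x⁻¹ * γ * x) = φ γ) ∧ φ 1 = 1}

/-- The set of characters of `Γ`: the extreme points of the convex set of traces. -/
def characters (Γ : Type u) [Group Γ] : Set (Γ → ℂ) :=
  (traces Γ).extremePoints ℝ

/-- `π` is the GNS representation `π_φ` of `φ`: it has a cyclic vector `v` with
`φ(γ) = ⟨π(γ) v, v⟩`. This determines `π` up to unitary equivalence; for a trace `φ` the vector `v`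
is a unit vector because `φ 1 = 1`. -/
def IsGNS (φ : Γ → ℂ) (π : UnitaryRep.{u, w} Γ) : Prop :=
  ∃ v : π.H, (Submodule.span ℂ (Set.range fun γ => π.toHom γ v)).topologicalClosure = ⊤ ∧
    ∀ γ, φ γ = inner ℂ v (π.toHom γ v)

/-- The characters `φ` of `Γ` whose GNS representation belongs to `R`. -/
def charactersIn (R : Set (UnitaryRep.{u, w} Γ)) : Set (Γ → ℂ) :=
  {φ | φ ∈ characters Γ ∧ ∃ π ∈ R, IsGNS φ π}

/-- `φ` is amenable: its GNS representation `π` is amenable in the sense of Bekka, that is,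
`π ⊗ π*` admits almost invariant vectors. -/
def IsAmenableTrace (φ : Γ → ℂ) : Prop :=
  ∃ π : UnitaryRep.{u, w} Γ, IsGNS φ π ∧ (π.tensor π.dual).HasAlmostInvariantVectors

end Traces

/-! ### Isometries determined by Gram matrices -/

section Gram

variable {ι E F : Type*} [NormedAddCommGroup E] [InnerProductSpace ℂ E]
  [NormedAddCommGroup F] [InnerProductSpace ℂ F]

/-! Property `T(R)` yields one pair `(Q, ε)` for which every member of `R` has a spectral gap
(`PropertyT.exists_hasGap`). The proof applies this gap to two kinds of representations and passes
to limits through inequalities in finitely many values of the characters.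

Limits are characters. Since φ is a trace, Γ × Γ acts on its GNS space by left and right
translations. The restrictions to the factors are equivalent to π and π*, so the diagonal
restriction, the conjugation representation, lies in `R`. Extremality of φ says that its invariant
vectors are the multiples of the cyclic vector. The gap orthogonal to that vector is the condition
`ConjGap`, which is closed under pointwise convergence and in turn forces extremality
(`ConjGap.mem_characters`).

Limits are not amenable. If ψ is amenable, an almost invariant vector of π_ψ ⊗ π_ψ* can be taken to
be a finite combination of translates, so that its almost invariance is an open condition on ψ and
passes to the φ_n near ψ. The gap of π_{φ_n} ⊗ π_{φ_n}* ∈ `R` then gives a nonzero Hilbert–Schmidt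
intertwiner. A spectral subspace of it is a finite-dimensional subrepresentation whose dimension is
bounded independently of n, and by extremality φ_n is the normalized character of an irreducible
piece. If infinitely many φ_n were near ψ, two of them would have irreducible pieces σ, τ of the
same dimension. Equality of dimensions puts σ ⊗ τ* in `R`, the same open condition gives it an
invariant vector, and so σ ≅ τ, against distinctness (`not_mapClusterPt_of_amenable`).

The dichotomy now makes every accumulation point vanish outside N, and compactness of a product of
discs gives the convergence. -/

theorem denseRange_linearCombination {a : ι → E}
    (hd : (Submodule.span ℂ (Set.range a)).topologicalClosure = ⊤) :
    DenseRange (Finsupp.linearCombination ℂ a) := by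
  rw [← Finsupp.range_linearCombination] at hd
  exact Submodule.dense_iff_topologicalClosure_eq_top.mpr hd

theorem norm_linearCombination_eq {a : ι → E} {b : ι → F}
    (h : ∀ i j, inner ℂ (a i) (a j) = inner ℂ (b i) (b j)) (x : ι →₀ ℂ) :
    ‖Finsupp.linearCombination ℂ a x‖ = ‖Finsupp.linearCombination ℂ b x‖ := by
  rw [← sq_eq_sq₀ (norm_nonneg _) (norm_nonneg _), ← inner_self_eq_norm_sq (𝕜 := ℂ),
    ← inner_self_eq_norm_sq (𝕜 := ℂ)]
  simp only [Finsupp.linearCombination_apply, Finsupp.sum, sum_inner, inner_sum, inner_smul_left,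
    inner_smul_right, h]

/-- A family with dense span is mapped isometrically onto any family with the same Gram matrix. -/
theorem exists_linearIsometry_of_inner_eq [CompleteSpace F] {a : ι → E} {b : ι → F}
    (hd : (Submodule.span ℂ (Set.range a)).topologicalClosure = ⊤)
    (h : ∀ i j, inner ℂ (a i) (a j) = inner ℂ (b i) (b j)) :
    ∃ V : E →ₗᵢ[ℂ] F, ∀ i, V (a i) = b i := by
  have hden := denseRange_linearCombination hd
  have hn := norm_linearCombination_eq h
  have hV : ∀ x, (Finsupp.linearCombination ℂ b).extendOfNorm (Finsupp.linearCombination ℂ a)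
      (Finsupp.linearCombination ℂ a x) = Finsupp.linearCombination ℂ b x :=
    LinearMap.extendOfNorm_eq hden ⟨1, fun x => by rw [hn, one_mul]⟩
  refine ⟨⟨((Finsupp.linearCombination ℂ b).extendOfNorm
    (Finsupp.linearCombination ℂ a)).toLinearMap, fun x => ?_⟩, fun i => ?_⟩
  · induction x using hden.induction_on with
    | hp => exact isClosed_eq (by fun_prop) continuous_norm
    | ih x => 
      change ‖(Finsupp.linearCombination ℂ b).extendOfNorm (Finsupp.linearCombination ℂ a)
        (Finsupp.linearCombination ℂ a x)‖ = _
      rw [hV, hn]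
  · simpa using hV (Finsupp.single i 1)

theorem eq_of_eq_on_family {a : ι → E}
    (hd : (Submodule.span ℂ (Set.range a)).topologicalClosure = ⊤) {f g : E →L[ℂ] F}
    (h : ∀ i, f (a i) = g (a i)) : f = g :=
  ContinuousLinearMap.ext_on (Submodule.dense_iff_topologicalClosure_eq_top.mpr hd)
    (by rintro _ ⟨i, rfl⟩; exact h i)

theorem eq_zero_of_inner_family_eq_zero {a : ι → E}
    (hd : (Submodule.span ℂ (Set.range a)).topologicalClosure = ⊤) {x : E}
    (h : ∀ i, inner ℂ x (a i) = 0) : x = 0 := by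
  have h0 : innerSL ℂ x = 0 := eq_of_eq_on_family hd (by simpa using h)
  rw [← inner_self_eq_zero (𝕜 := ℂ)]
  simpa using congr($h0 x)

/-- A group acting on a family with dense span while preserving its Gram matrix acts unitarily. -/
theorem exists_unitary_hom_of_inner_eq [CompleteSpace E] {G : Type*} [Group G]
    (act : G →* Equiv.Perm ι) {a : ι → E}
    (hd : (Submodule.span ℂ (Set.range a)).topologicalClosure = ⊤)
    (h : ∀ g i j, inner ℂ (a (act g i)) (a (act g j)) = inner ℂ (a i) (a j)) :
    ∃ ρ : G →* (E ≃ₗᵢ[ℂ] E), ∀ g i, ρ g (a i) = a (act g i) := by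
  have hex : ∀ g, ∃ V : E →ₗᵢ[ℂ] E, ∀ i, V (a i) = a (act g i) := fun g =>
    exists_linearIsometry_of_inner_eq hd fun i j => (h g i j).symm
  choose V hV using hex
  have hmul : ∀ g k x, V (g * k) x = V g (V k x) := fun g k x => by
    have := eq_of_eq_on_family hd (f := (V (g * k)).toContinuousLinearMap)
      (g := (V g).toContinuousLinearMap.comp (V k).toContinuousLinearMap)
      (fun i => by simp [hV])
    exact congr($this x)
  have hone : ∀ x, V 1 x = x := fun x => by
    have := eq_of_eq_on_family hd (f := (V 1).toContinuousLinearMap)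
      (g := ContinuousLinearMap.id ℂ E) (fun i => by simp [hV])
    exact congr($this x)
  refine ⟨{ toFun := fun g =>
              { toLinearEquiv := LinearEquiv.ofLinearMap (V g).toLinearMap (V g⁻¹).toLinearMap
                  (by ext x; simp [← hmul, hone]) (by ext x; simp [← hmul, hone])
                norm_map' := (V g).norm_map }
            map_one' := by ext x; exact hone x
            map_mul' := fun g k => by ext x; exact hmul g k x }, fun g i => hV g i⟩

end Gram

/-! ### Elementary identities for unitary representations. -/

namespace UnitaryRep

variable {Γ : Type u} [Group Γ]

@[simp] theorem toHom_mul_apply (π : UnitaryRep.{u, w} Γ) (g h : Γ) (x : π.H) :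
    π.toHom (g * h) x = π.toHom g (π.toHom h x) := by
  rw [map_mul]; rfl

@[simp] theorem toHom_one_apply (π : UnitaryRep.{u, w} Γ) (x : π.H) : π.toHom 1 x = x := by
  rw [map_one]; rfl

theorem inner_toHom_left (π : UnitaryRep.{u, w} Γ) (g : Γ) (x y : π.H) :
    inner ℂ (π.toHom g x) y = inner ℂ x (π.toHom g⁻¹ y) := by
  rw [← (π.toHom g).inner_map_map x, ← toHom_mul_apply]; simp

theorem norm_toHom_sub_sq (π : UnitaryRep.{u, w} Γ) (g : Γ) (x : π.H) :
    ‖π.toHom g x - x‖ ^ 2 = 2 * ‖x‖ ^ 2 - 2 * (inner ℂ x (π.toHom g x)).re := by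
  rw [norm_sub_rev, norm_sub_sq (𝕜 := ℂ), LinearIsometryEquiv.norm_map]
  simp only [RCLike.re_eq_complex_re]; ring

theorem mem_invariants {π : UnitaryRep.{u, w} Γ} {x : π.H} :
    x ∈ π.invariants ↔ ∀ γ, π.toHom γ x = x := Iff.rfl

theorem isClosed_invariants (π : UnitaryRep.{u, w} Γ) : IsClosed (π.invariants : Set π.H) := by
  have : (π.invariants : Set π.H) = ⋂ γ, {x | π.toHom γ x = x} := by
    ext x; simp [mem_invariants]
  rw [this]
  exact isClosed_iInter fun γ => isClosed_eq (π.toHom γ).continuous continuous_id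

instance (π : UnitaryRep.{u, w} Γ) : CompleteSpace π.invariants :=
  π.isClosed_invariants.completeSpace_coe

/-! ### The spectral gap -/

/-- The spectral gap inequality with respect to the finite set `Q` and the constant `ε`. -/
def HasGap (Q : Finset Γ) (ε : ℝ) (π : UnitaryRep.{u, w} Γ) : Prop :=
  ∀ x ∈ (π.invariants)ᗮ, ε ^ 2 * ‖x‖ ^ 2 ≤ ∑ γ ∈ Q, ‖π.toHom γ x - x‖ ^ 2

/-- Coefficients of the trivial representation are nonnegative constants, and a nearly invariant
vector has a nearly constant coefficient. The strict inequality at the trivial representation leaves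
room for the error. -/
theorem mem_fellNhd_of_almost_invariant {π : UnitaryRep.{u, w} Γ} {n : ℕ} {ξ : Fin n → π.H}
    {Q : Finset Γ} {ε : ℝ} (hπ : trivial.{u, w} Γ ∈ fellNhd π ξ Q ε) :
    ∀ᶠ δ in 𝓝[>] (0 : ℝ), ∀ (σ : UnitaryRep.{u, w} Γ) (x : σ.H), ‖x‖ = 1 →
      (∀ γ ∈ Q, ‖σ.toHom γ x - x‖ < δ) → σ ∈ fellNhd π ξ Q ε := by
  choose m η hη using hπ
  have hc : ∀ i, ∀ γ ∈ Q, ‖inner ℂ (ξ i) (π.toHom γ (ξ i)) - ((∑ j, ‖η i j‖ ^ 2 : ℝ) : ℂ)‖ < ε := by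
    intro i γ hγ
    convert hη i γ hγ using 3
    push_cast
    refine Finset.sum_congr rfl fun j _ => ?_
    change _ = inner ℂ (η i j) (η i j)
    rw [inner_self_eq_norm_sq_to_K]; rfl
  set c : Fin n → ℝ := fun i => ∑ j, ‖η i j‖ ^ 2 with hcdef
  have hc0 : ∀ i, 0 ≤ c i := fun i => by positivity
  have hδ : ∀ᶠ δ in 𝓝[>] (0 : ℝ), ∀ i, ∀ γ ∈ Q,
      ‖inner ℂ (ξ i) (π.toHom γ (ξ i)) - (c i : ℂ)‖ + c i * δ < ε := by
    rw [Filter.eventually_all]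
    intro i
    rw [Filter.eventually_all_finset]
    intro γ hγ
    have : Filter.Tendsto (fun δ : ℝ => ‖inner ℂ (ξ i) (π.toHom γ (ξ i)) - (c i : ℂ)‖ + c i * δ)
        (𝓝[>] 0) (𝓝 (‖inner ℂ (ξ i) (π.toHom γ (ξ i)) - (c i : ℂ)‖ + c i * 0)) :=
      tendsto_nhdsWithin_of_tendsto_nhds (Continuous.tendsto (by fun_prop) 0)
    refine this.eventually_lt_const ?_
    rw [mul_zero, add_zero]
    exact hc i γ hγ
  filter_upwards [hδ] with δ hδ σ x hx hinv i
  -- Rescaling by the square root turns a coefficient close to 1 into one close to `c i`, with error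
  -- at most `c i * δ`.
  refine ⟨1, fun _ => (Real.sqrt (c i) : ℂ) • x, fun γ hγ => ?_⟩
  have h1 : ∑ _j : Fin 1,
      inner ℂ ((Real.sqrt (c i) : ℂ) • x) (σ.toHom γ ((Real.sqrt (c i) : ℂ) • x))
      = (c i : ℂ) + (c i : ℂ) * inner ℂ x (σ.toHom γ x - x) := by
    have hs : (Real.sqrt (c i) : ℂ) * (Real.sqrt (c i) : ℂ) = c i := by
      rw [← Complex.ofReal_mul, Real.mul_self_sqrt (hc0 i)]
    simp only [Finset.univ_unique, Finset.sum_singleton, map_smul, inner_smul_left,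
      inner_smul_right, Complex.conj_ofReal, inner_sub_right, inner_self_eq_norm_sq_to_K, hx]
    rw [← mul_assoc, hs]; push_cast; ring
  rw [h1, ← sub_sub]
  refine lt_of_le_of_lt (norm_sub_le _ _) (lt_of_le_of_lt ?_ (hδ i γ hγ))
  gcongr
  rw [norm_mul, Complex.norm_real, Real.norm_of_nonneg (hc0 i)]
  refine mul_le_mul_of_nonneg_left ?_ (hc0 i)
  refine (norm_inner_le_norm _ _).trans ?_
  rw [hx, one_mul]
  exact (hinv γ hγ).le

theorem exists_almost_invariant_mem_of_isOpen {U : Set (UnitaryRep.{u, w} Γ)}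
    (hU : IsOpen[fellTopology Γ] U) (h1 : trivial.{u, w} Γ ∈ U) :
    ∃ (Q : Finset Γ) (δ : ℝ), 0 < δ ∧ ∀ (σ : UnitaryRep.{u, w} Γ) (x : σ.H), ‖x‖ = 1 →
      (∀ γ ∈ Q, ‖σ.toHom γ x - x‖ < δ) → σ ∈ U := by
  classical
  induction hU with
  | basic W hW =>
    obtain ⟨π, n, ξ, Q, ε, -, rfl⟩ := hW
    obtain ⟨δ, hδ, h0⟩ :=
      ((mem_fellNhd_of_almost_invariant h1).and self_mem_nhdsWithin).exists
    exact ⟨Q, δ, h0, hδ⟩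
  | univ => exact ⟨∅, 1, one_pos, fun _ _ _ _ => Set.mem_univ _⟩
  | inter s t _ _ hs ht =>
    obtain ⟨Q, δ, h0, h⟩ := hs h1.1
    obtain ⟨Q', δ', h0', h'⟩ := ht h1.2
    refine ⟨Q ∪ Q', min δ δ', lt_min h0 h0', fun σ x hx hi => ⟨h σ x hx fun γ hγ => ?_,
      h' σ x hx fun γ hγ => ?_⟩⟩
    · exact (hi γ (Finset.mem_union_left _ hγ)).trans_le (min_le_left _ _)
    · exact (hi γ (Finset.mem_union_right _ hγ)).trans_le (min_le_right _ _)
  | sUnion S _ hS =>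
    obtain ⟨s, hsS, hs⟩ := h1
    obtain ⟨Q, δ, h0, h⟩ := hS s hsS hs
    exact ⟨Q, δ, h0, fun σ x hx hi => ⟨s, hsS, h σ x hx hi⟩⟩

theorem eq_zero_of_invariant_nontrivialPart {π : UnitaryRep.{u, w} Γ} {x : π.nontrivialPart.H}
    (hx : ∀ γ, π.nontrivialPart.toHom γ x = x) : x = 0 := by
  change (π.invariants)ᗮ at x
  have h1 : (x : π.H) ∈ π.invariants := fun γ => congrArg Subtype.val (hx γ)
  have h2 := (Submodule.mem_orthogonal _ _).mp x.2 _ h1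
  exact Subtype.ext (inner_self_eq_zero.mp h2)

/-- Isolation of the trivial representation is only up to equivalence; this excludes that some π₀ is
the trivial representation itself. -/
theorem not_isEquiv_nontrivialPart_trivial (π : UnitaryRep.{u, w} Γ) :
    ¬ IsEquiv π.nontrivialPart (trivial Γ) := by
  rintro ⟨V, hV⟩
  let e : (trivial.{u, w} Γ).H := EuclideanSpace.single PUnit.unit (1 : ℂ)
  have he : e ≠ 0 := by
    intro h
    change EuclideanSpace.single PUnit.unit (1 : ℂ) = (0 : EuclideanSpace ℂ PUnit) at h
    simpa using congr(‖$h‖)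
  have : V.symm e = 0 := eq_zero_of_invariant_nontrivialPart fun γ => V.injective (by
    rw [hV, V.apply_symm_apply]; rfl)
  exact he (by simpa using this)

/-- A vector violating the inequality would, after normalization, be a unit vector of π₀ almost
fixed by `Q`, which places π₀ in the isolating neighbourhood. The pair depends only on that
neighbourhood, hence is uniform over `R`. -/
theorem PropertyT.exists_hasGap {R : Set (UnitaryRep.{u, w} Γ)} (hT : PropertyT R) :
    ∃ (Q : Finset Γ) (ε : ℝ), 0 < ε ∧ ∀ π ∈ R, HasGap Q ε π := by
  obtain ⟨U, hU, h1, hiso⟩ := hT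
  obtain ⟨Q, δ, h0, h⟩ := exists_almost_invariant_mem_of_isOpen hU h1
  refine ⟨Q, δ, h0, fun π hπ x hx => ?_⟩
  by_cases hx0 : x = 0
  · simp [hx0]
  have hn : 0 < ‖x‖ := norm_pos_iff.mpr hx0
  have hex : ∃ γ ∈ Q, δ * ‖x‖ ≤ ‖π.toHom γ x - x‖ := by
    by_contra! hcon
    refine not_isEquiv_nontrivialPart_trivial π (hiso _ ⟨h π.nontrivialPart
      (show (π.invariants)ᗮ from ((‖x‖⁻¹ : ℝ) : ℂ) • ⟨x, hx⟩) ?_ fun γ hγ => ?_,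
      Or.inl ⟨π, hπ, rfl⟩⟩)
    · change ‖((‖x‖⁻¹ : ℝ) : ℂ) • x‖ = 1
      rw [norm_smul, Complex.norm_real, norm_inv, norm_norm, inv_mul_cancel₀ hn.ne']
    · change ‖π.toHom γ (((‖x‖⁻¹ : ℝ) : ℂ) • x) - ((‖x‖⁻¹ : ℝ) : ℂ) • x‖ < δ
      rw [map_smul, ← smul_sub, norm_smul, Complex.norm_real, norm_inv, norm_norm,
        inv_mul_lt_iff₀ hn, mul_comm]
      exact hcon γ hγ
  obtain ⟨γ, hγ, hle⟩ := hex
  calc δ ^ 2 * ‖x‖ ^ 2 = (δ * ‖x‖) ^ 2 := by ring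
    _ ≤ ‖π.toHom γ x - x‖ ^ 2 := by gcongr
    _ ≤ _ := Finset.single_le_sum (f := fun γ => ‖π.toHom γ x - x‖ ^ 2)
      (fun _ _ => by positivity) hγ

/-- The gap inequality bounds the distance of a vector to the invariant vectors. -/
theorem HasGap.dist_invariants_le {Q : Finset Γ} {ε : ℝ} {π : UnitaryRep.{u, w} Γ}
    (h : HasGap Q ε π) (x : π.H) :
    ∃ y ∈ π.invariants, inner ℂ y (x - y) = 0 ∧
      ε ^ 2 * ‖x - y‖ ^ 2 ≤ ∑ γ ∈ Q, ‖π.toHom γ x - x‖ ^ 2 := by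
  obtain ⟨y, hy, z, hz, rfl⟩ := π.invariants.exists_add_mem_mem_orthogonal x
  refine ⟨y, hy, ?_, ?_⟩
  · rw [add_sub_cancel_left]; exact (Submodule.mem_orthogonal _ _).mp hz y hy
  · rw [add_sub_cancel_left]
    refine (h z hz).trans (Finset.sum_le_sum fun γ _ => ?_)
    rw [map_add, hy γ, add_sub_add_left_eq_sub]

end UnitaryRep

/-! ### Extremality -/

section QuadForm

variable {Γ : Type u} [Group Γ]

/-- The quadratic form on finitely supported functions attached to a function on a group. -/
noncomputable def quadForm (f : Γ → ℂ) {n : ℕ} (g : Fin n → Γ) (α : Fin n → ℂ) : ℂ :=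
  ∑ i, ∑ j, α i * (starRingEnd ℂ) (α j) * f ((g j)⁻¹ * g i)

theorem quadForm_add_smul (f f' : Γ → ℂ) (c : ℂ) {n : ℕ} (g : Fin n → Γ) (α : Fin n → ℂ) :
    quadForm (fun γ => f γ + c * f' γ) g α = quadForm f g α + c * quadForm f' g α := by
  simp only [quadForm, Finset.mul_sum, ← Finset.sum_add_distrib]
  refine Finset.sum_congr rfl fun i _ => Finset.sum_congr rfl fun j _ => ?_
  ring

theorem quadForm_const_mul (f : Γ → ℂ) (c : ℂ) {n : ℕ} (g : Fin n → Γ) (α : Fin n → ℂ) :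
    quadForm (fun γ => c * f γ) g α = c * quadForm f g α := by
  simp only [quadForm, Finset.mul_sum]
  refine Finset.sum_congr rfl fun i _ => Finset.sum_congr rfl fun j _ => ?_
  ring

theorem quadForm_conj_inv (f : Γ → ℂ) {n : ℕ} (g : Fin n → Γ) (α : Fin n → ℂ) :
    quadForm (fun γ => (starRingEnd ℂ) (f γ⁻¹)) g α = (starRingEnd ℂ) (quadForm f g α) := by
  simp only [quadForm, map_sum, map_mul, Complex.conj_conj, mul_inv_rev, inv_inv]
  rw [Finset.sum_comm]
  refine Finset.sum_congr rfl fun i _ => Finset.sum_congr rfl fun j _ => ?_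
  ring

theorem quadForm_one (f : Γ → ℂ) : quadForm f (fun _ : Fin 1 => 1) (fun _ => 1) = f 1 := by
  simp [quadForm]

theorem isPositiveDefinite_iff {φ : Γ → ℂ} : IsPositiveDefinite φ ↔
    ∀ (n : ℕ) (g : Fin n → Γ) (α : Fin n → ℂ),
      0 ≤ (quadForm φ g α).re ∧ (quadForm φ g α).im = 0 := Iff.rfl

theorem IsPositiveDefinite.apply_inv {φ : Γ → ℂ} (h : IsPositiveDefinite φ) (γ : Γ) :
    φ γ⁻¹ = (starRingEnd ℂ) (φ γ) := by
  -- Polarization: reality of the form for coefficients (1, 1) compares imaginary parts, and for (1,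
  -- i) it compares real parts.
  have h0 := (h 1 (fun _ => 1) (fun _ => 1)).2
  have h1 := (h 2 ![1, γ] ![1, 1]).2
  have h2 := (h 2 ![1, γ] ![1, Complex.I]).2
  simp [Fin.sum_univ_two] at h0 h1 h2
  apply Complex.ext
  · simp; linarith
  · simp; linarith

/-- For small real s the functions φ ± s f, once normalized, are traces having φ as a proper convex
combination, so extremality makes both equal to φ. -/
theorem eq_smul_of_dominated_of_real {φ : Γ → ℂ} (hφ : φ ∈ characters Γ) {f : Γ → ℂ}
    (hf : ∀ γ x, f (x⁻¹ * γ * x) = f γ) {C : ℝ} (hC : 0 < C)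
    (him : ∀ (n : ℕ) (g : Fin n → Γ) (α : Fin n → ℂ), (quadForm f g α).im = 0)
    (hdom : ∀ (n : ℕ) (g : Fin n → Γ) (α : Fin n → ℂ),
      |(quadForm f g α).re| ≤ C * (quadForm φ g α).re) (γ : Γ) :
    f γ = f 1 * φ γ := by
  obtain ⟨⟨hpd, hinv, hone⟩, hext⟩ := mem_extremePoints.mp hφ
  set r : ℝ := (f 1).re with hr
  have hr1 : f 1 = r := by
    apply Complex.ext
    · simp [hr]
    · have := him 1 (fun _ => 1) (fun _ => 1)
      rw [quadForm_one] at this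
      simpa using this
  have hrC : |r| ≤ C := by
    have := hdom 1 (fun _ => 1) (fun _ => 1)
    rw [quadForm_one, quadForm_one, hone] at this
    simpa using this
  -- This size of s keeps φ + s f positive definite and makes |s r| ≤ 1/2, so the normalizing factor
  -- stays positive.
  have key : ∀ s : ℝ, |s| ≤ (2 * C)⁻¹ → 0 < 1 + s * r ∧
      (fun γ => ((1 + s * r : ℝ) : ℂ)⁻¹ * (φ γ + (s : ℂ) * f γ)) ∈ traces Γ := by
    intro s hs
    have hsr : |s * r| ≤ 1 / 2 := by
      rw [abs_mul]
      calc |s| * |r| ≤ (2 * C)⁻¹ * C := by gcongr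
        _ = 1 / 2 := by field_simp
    have hpos : 0 < 1 + s * r := by have := (abs_le.mp hsr).1; linarith
    refine ⟨hpos, isPositiveDefinite_iff.mpr fun n g α => ?_,
      fun γ x => by simp only [hinv, hf], ?_⟩
    · have h1 := isPositiveDefinite_iff.mp hpd n g α
      rw [quadForm_const_mul, quadForm_add_smul, ← Complex.ofReal_inv, Complex.re_ofReal_mul,
        Complex.im_ofReal_mul, Complex.add_re, Complex.add_im, Complex.re_ofReal_mul,
        Complex.im_ofReal_mul, h1.2, him]
      refine ⟨mul_nonneg (inv_nonneg.mpr hpos.le) ?_, by simp⟩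
      have h2 : |s * (quadForm f g α).re| ≤ (quadForm φ g α).re := by
        rw [abs_mul]
        calc |s| * |(quadForm f g α).re| ≤ (2 * C)⁻¹ * (C * (quadForm φ g α).re) := by
              gcongr; exact hdom n g α
          _ = (quadForm φ g α).re / 2 := by field_simp
          _ ≤ _ := by linarith [h1.1]
      linarith [(abs_le.mp h2).1]
    · change _ * (φ 1 + s * f 1) = 1
      rw [hone, hr1]
      have : ((1 + s * r : ℝ) : ℂ) ≠ 0 := by exact_mod_cast hpos.ne'
      rw [inv_mul_eq_one₀ this]; push_cast; ring
  set s : ℝ := (2 * C)⁻¹ with hs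
  have hs0 : 0 < s := by positivity
  obtain ⟨hp, hmemp⟩ := key s (by rw [abs_of_pos hs0])
  obtain ⟨hm, hmemm⟩ := key (-s) (by rw [abs_neg, abs_of_pos hs0])
  have hpc : ((1 + s * r : ℝ) : ℂ) ≠ 0 := by exact_mod_cast hp.ne'
  have hmc : ((1 + -s * r : ℝ) : ℂ) ≠ 0 := by exact_mod_cast hm.ne'
  -- The weights (1 ± s r)/2 undo the normalizations, after which the terms ± s f cancel.
  have h := (hext _ hmemp _ hmemm ⟨(1 + s * r) / 2, (1 + -s * r) / 2, by positivity, by positivity,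
    by ring, by
      have e : ∀ A X : ℂ, A ≠ 0 → A / 2 * (A⁻¹ * X) = X / 2 := fun A X hA => by field_simp
      ext γ
      simp only [Pi.add_apply, Pi.smul_apply, Complex.real_smul, Complex.ofReal_div,
        Complex.ofReal_ofNat]
      rw [e _ _ hpc, e _ _ hmc]
      push_cast
      ring⟩).1
  have h1 : ((1 + s * r : ℝ) : ℂ)⁻¹ * (φ γ + s * f γ) = φ γ := congrFun h γ
  rw [inv_mul_eq_iff_eq_mul₀ hpc] at h1
  have hsc : (s : ℂ) ≠ 0 := by exact_mod_cast hs0.ne'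
  rw [hr1]
  apply mul_left_cancel₀ hsc
  push_cast at h1
  linear_combination h1

/-- A conjugation-invariant function whose quadratic form is dominated by that of a character is a
multiple of it. -/
theorem eq_smul_of_dominated {φ : Γ → ℂ} (hφ : φ ∈ characters Γ) {f : Γ → ℂ}
    (hf : ∀ γ x, f (x⁻¹ * γ * x) = f γ) {C : ℝ} (hC : 0 < C)
    (hdom : ∀ (n : ℕ) (g : Fin n → Γ) (α : Fin n → ℂ),
      ‖quadForm f g α‖ ≤ C * (quadForm φ g α).re) (γ : Γ) :
    f γ = f 1 * φ γ := by
  have hfs : ∀ γ x, (starRingEnd ℂ) (f (x⁻¹ * γ * x)⁻¹) = (starRingEnd ℂ) (f γ⁻¹) := by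
    intro γ x
    rw [← hf γ⁻¹ x]; congr 2; group
  -- With f*(γ) the conjugate of f(γ⁻¹), the function z f + z̄ f* has a real form bounded by 2C. The
  -- cases z = 1 and z = i recover f.
  have key : ∀ z : ℂ, ‖z‖ = 1 → ∀ γ, (fun γ => z * f γ + (starRingEnd ℂ) z *
      (starRingEnd ℂ) (f γ⁻¹)) γ = (z * f 1 + (starRingEnd ℂ) z * (starRingEnd ℂ) (f 1)) * φ γ := by
    intro z hz
    have hq : ∀ (n : ℕ) (g : Fin n → Γ) (α : Fin n → ℂ), quadForm (fun γ => z * f γ +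
        (starRingEnd ℂ) z * (starRingEnd ℂ) (f γ⁻¹)) g α =
        ((2 * (z * quadForm f g α).re : ℝ) : ℂ) := by
      intro n g α
      rw [quadForm_add_smul (fun γ => z * f γ), quadForm_conj_inv, quadForm_const_mul,
        ← map_mul, Complex.add_conj]
    intro γ
    have := eq_smul_of_dominated_of_real hφ (f := fun γ => z * f γ + (starRingEnd ℂ) z *
      (starRingEnd ℂ) (f γ⁻¹)) (fun γ x => by simp only [hf, hfs]) (C := 2 * C) (by positivity)
      (fun n g α => by rw [hq, Complex.ofReal_im]) (fun n g α => ?_) γ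
    · simpa using this
    · rw [hq, Complex.ofReal_re, abs_mul, abs_two, mul_assoc]
      gcongr
      refine (Complex.abs_re_le_norm _).trans ?_
      rw [norm_mul, hz, one_mul]
      exact hdom n g α
  have h1 := key 1 (by simp) γ
  have h2 := key Complex.I (by simp) γ
  simp only [one_mul, map_one, Complex.conj_I] at h1 h2
  have hI := Complex.I_mul_I
  linear_combination (1 / 2) * h1 - (Complex.I / 2) * h2 + (1 / 2) *
    (f γ - (starRingEnd ℂ) (f γ⁻¹) - (f 1 - (starRingEnd ℂ) (f 1)) * φ γ) * hI

end QuadForm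

/-! ### GNS vectors of a trace and the two-sided action. -/

namespace UnitaryRep

variable {Γ : Type u} [Group Γ]

/-- `v` is a cyclic vector of `π` realizing `φ`. -/
def IsGNSVector (φ : Γ → ℂ) (π : UnitaryRep.{u, w} Γ) (v : π.H) : Prop :=
  (Submodule.span ℂ (Set.range fun γ => π.toHom γ v)).topologicalClosure = ⊤ ∧
    ∀ γ, φ γ = inner ℂ v (π.toHom γ v)

namespace IsGNSVector

variable {φ : Γ → ℂ} {π : UnitaryRep.{u, w} Γ} {v : π.H}

theorem inner_eq (h : IsGNSVector φ π v) (i j : Γ) :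
    inner ℂ (π.toHom i v) (π.toHom j v) = φ (i⁻¹ * j) := by
  rw [inner_toHom_left, h.2, toHom_mul_apply]

theorem norm_eq_one (h : IsGNSVector φ π v) (hφ : φ ∈ traces Γ) : ‖v‖ = 1 := by
  have h1 := h.2 1
  rw [hφ.2.2, toHom_one_apply] at h1
  rw [← pow_eq_one_iff_of_nonneg (norm_nonneg v) two_ne_zero, ← inner_self_eq_norm_sq (𝕜 := ℂ),
    ← h1]
  simp

theorem quadForm_eq (h : IsGNSVector φ π v) {n : ℕ} (g : Fin n → Γ) (α : Fin n → ℂ) :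
    quadForm φ g α = ((‖∑ i, α i • π.toHom (g i) v‖ ^ 2 : ℝ) : ℂ) := by
  have := inner_self_eq_norm_sq_to_K (𝕜 := ℂ) (∑ i, α i • π.toHom (g i) v)
  rw [Complex.ofReal_pow]
  refine Eq.trans ?_ this
  simp only [sum_inner, inner_sum, inner_smul_left, inner_smul_right, h.inner_eq, quadForm,
    Finset.mul_sum]
  refine Finset.sum_congr rfl fun i _ => Finset.sum_congr rfl fun j _ => ?_
  ring

/-- Replacing each g by g k conjugates the arguments of φ by k. Thus right translation is isometric
for a trace. -/
theorem norm_sum_translate (h : IsGNSVector φ π v) (hφ : φ ∈ traces Γ) {n : ℕ} (g : Fin n → Γ)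
    (α : Fin n → ℂ) (k : Γ) :
    ‖∑ i, α i • π.toHom (g i * k) v‖ = ‖∑ i, α i • π.toHom (g i) v‖ := by
  have h1 := h.quadForm_eq g α
  have h2 := h.quadForm_eq (fun i => g i * k) α
  have h3 : quadForm φ (fun i => g i * k) α = quadForm φ g α := by
    simp only [quadForm]
    refine Finset.sum_congr rfl fun i _ => Finset.sum_congr rfl fun j _ => ?_
    rw [← hφ.2.1 ((g j)⁻¹ * g i) k]; congr 2; group
  rw [h3, h1] at h2
  rw [← sq_eq_sq₀ (norm_nonneg _) (norm_nonneg _)]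
  exact_mod_cast h2.symm

end IsGNSVector

/-- A group acting on the space of `π`, as a representation. -/
abbrev withHom {Λ : Type u} [Group Λ] (π : UnitaryRep.{u, w} Γ) (c : Λ →* (π.H ≃ₗᵢ[ℂ] π.H)) :
    UnitaryRep.{u, w} Λ where
  H := π.H
  toHom := c

/-- The action of `Γ × Γ` on `Γ` by left and right translations. -/
def biTranslate (Γ : Type u) [Group Γ] : Γ × Γ →* Equiv.Perm Γ where
  toFun p := (Equiv.mulLeft p.1).trans (Equiv.mulRight p.2⁻¹)
  map_one' := by ext; simp
  map_mul' p q := by ext; simp [mul_assoc]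

@[simp] theorem biTranslate_apply (p : Γ × Γ) (k : Γ) :
    biTranslate Γ p k = p.1 * k * p.2⁻¹ := rfl

/-- Conjugation invariance is what lets right translations, and not only left ones, preserve the
Gram matrix of the orbit of `v`. -/
theorem IsGNSVector.exists_biHom {φ : Γ → ℂ} {π : UnitaryRep.{u, w} Γ} {v : π.H}
    (h : IsGNSVector φ π v) (hφ : φ ∈ traces Γ) : ∃ ρ : Γ × Γ →* (π.H ≃ₗᵢ[ℂ] π.H),
      ∀ p k, ρ p (π.toHom k v) = π.toHom (p.1 * k * p.2⁻¹) v := by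
  obtain ⟨ρ, hρ⟩ := exists_unitary_hom_of_inner_eq (biTranslate Γ) h.1 (fun p i j => by
    rw [h.inner_eq, h.inner_eq, biTranslate_apply, biTranslate_apply,
      ← hφ.2.1 (i⁻¹ * j) p.2⁻¹]
    congr 1; group)
  exact ⟨ρ, hρ⟩

/-! ### Vectors of the dual representation -/

/-- The vector of the dual representation corresponding to `x`. -/
noncomputable def dualVec (π : UnitaryRep.{u, w} Γ) (x : π.H) : π.dual.H :=
  InnerProductSpace.toDual ℂ π.H x

variable (π : UnitaryRep.{u, w} Γ)

theorem inner_dualVec (x y : π.H) : inner ℂ (π.dualVec x) (π.dualVec y) = inner ℂ y x := by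
  change inner ℂ ((InnerProductSpace.toDual ℂ π.H).symm (InnerProductSpace.toDual ℂ π.H y))
    ((InnerProductSpace.toDual ℂ π.H).symm (InnerProductSpace.toDual ℂ π.H x)) = _
  simp

theorem norm_dualVec (x : π.H) : ‖π.dualVec x‖ = ‖x‖ :=
  (InnerProductSpace.toDual ℂ π.H).norm_map x

theorem dual_toHom_dualVec (γ : Γ) (x : π.H) :
    π.dual.toHom γ (π.dualVec x) = π.dualVec (π.toHom γ x) := by
  change InnerProductSpace.toDual ℂ π.H (π.toHom γ
    ((InnerProductSpace.toDual ℂ π.H).symm (InnerProductSpace.toDual ℂ π.H x))) = _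
  rw [LinearIsometryEquiv.symm_apply_apply]; rfl

theorem dualVec_surjective : Function.Surjective π.dualVec :=
  (InnerProductSpace.toDual ℂ π.H).surjective

theorem dualVec_add (x y : π.H) : π.dualVec (x + y) = π.dualVec x + π.dualVec y :=
  map_add (InnerProductSpace.toDual ℂ π.H) x y

theorem dualVec_smul (c : ℂ) (x : π.H) :
    π.dualVec (c • x) = (starRingEnd ℂ) c • π.dualVec x :=
  (InnerProductSpace.toDual ℂ π.H).map_smulₛₗ c x

theorem continuous_dualVec : Continuous π.dualVec :=
  (InnerProductSpace.toDual ℂ π.H).continuous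

variable {π}

theorem IsGNSVector.dual {φ : Γ → ℂ} {v : π.H} (h : IsGNSVector φ π v) :
    IsGNSVector (fun γ => (starRingEnd ℂ) (φ γ)) π.dual (π.dualVec v) := by
  refine ⟨?_, fun γ => ?_⟩
  · rw [Submodule.eq_top_iff']
    intro y
    obtain ⟨x, rfl⟩ := π.dualVec_surjective y
    have hx : x ∈ (Submodule.span ℂ (Set.range fun γ => π.toHom γ v)).topologicalClosure := by
      rw [h.1]; trivial
    rw [← SetLike.mem_coe, Submodule.topologicalClosure_coe] at hx ⊢
    refine map_mem_closure π.continuous_dualVec hx fun z hz => ?_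
    induction hz using Submodule.span_induction with
    | mem z hz =>
      obtain ⟨γ, rfl⟩ := hz
      exact Submodule.subset_span ⟨γ, π.dual_toHom_dualVec γ v⟩
    | zero => 
      rw [show π.dualVec 0 = 0 from map_zero (InnerProductSpace.toDual ℂ π.H)]
      exact Submodule.zero_mem _
    | add a b _ _ ha hb => rw [dualVec_add]; exact Submodule.add_mem _ ha hb
    | smul c a _ ha => rw [dualVec_smul]; exact Submodule.smul_mem _ _ ha
  · simp only [h.2, dual_toHom_dualVec, inner_dualVec, inner_conj_symm]

/-- The conjugation representation attached to a trace belongs to `R`. -/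
theorem IsGNSVector.exists_conj_mem {R : Set (UnitaryRep.{u, w} Γ)} (hR : IsHereditary R)
    {φ : Γ → ℂ} {v : π.H} (h : IsGNSVector φ π v) (hφ : φ ∈ traces Γ) (hπ : π ∈ R) :
    ∃ c : Γ →* (π.H ≃ₗᵢ[ℂ] π.H), (∀ g k, c g (π.toHom k v) = π.toHom (g * k * g⁻¹) v) ∧
      π.withHom c ∈ R := by
  obtain ⟨ρ, hρ⟩ := h.exists_biHom hφ
  have hL : (π.withHom ρ).restrictLeft ∈ R := by
    refine hR.mem_of_isSubrep _ π hπ ⟨LinearIsometry.id, fun γ x => ?_⟩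
    have := eq_of_eq_on_family h.1 (f := ((ρ (γ, 1)).toLinearIsometry.toContinuousLinearMap))
      (g := (π.toHom γ).toLinearIsometry.toContinuousLinearMap) (fun k => by simp [hρ])
    exact congr($this x)
  have hRt : (π.withHom ρ).restrictRight ∈ R := by
    refine hR.mem_of_isSubrep _ π.dual (hR.dual_mem _ hπ) ?_
    -- Inversion k ↦ k⁻¹ exchanges right and left translation, and passing to the dual corrects the
    -- resulting complex conjugation of the Gram matrix.
    obtain ⟨V, hV⟩ := exists_linearIsometry_of_inner_eq (b := fun k : Γ =>
      π.dualVec (π.toHom k⁻¹ v)) h.1 (fun i j => by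
        rw [inner_dualVec, h.inner_eq, h.inner_eq, ← hφ.2.1 (i⁻¹ * j) i⁻¹]
        congr 1; group)
    refine ⟨V, fun γ x => ?_⟩
    have := eq_of_eq_on_family h.1 (f := V.toContinuousLinearMap.comp
        (ρ (1, γ)).toLinearIsometry.toContinuousLinearMap)
      (g := (π.dual.toHom γ).toLinearIsometry.toContinuousLinearMap.comp V.toContinuousLinearMap)
      (fun k => by
        change V (ρ (1, γ) (π.toHom k v)) = π.dual.toHom γ (V (π.toHom k v))
        rw [hρ, hV, hV, dual_toHom_dualVec, ← toHom_mul_apply]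
        congr 3; group)
    exact congr($this x)
  exact ⟨ρ.comp ((MonoidHom.id Γ).prod (MonoidHom.id Γ)), fun g k => hρ (g, g) k,
    hR.restrictDiag_mem _ hL hRt⟩

/-! ### Invariant vectors of the conjugation representation -/

theorem exists_minimal_of_isClosed_convex {E : Type*} [NormedAddCommGroup E]
    [InnerProductSpace ℂ E] [CompleteSpace E] {K : Set E} (hne : K.Nonempty) (hc : IsClosed K)
    (hconv : Convex ℝ K) : ∃ p ∈ K, ∀ w ∈ K, ‖p‖ ^ 2 ≤ (inner ℂ p w).re := by
  let : InnerProductSpace ℝ E := InnerProductSpace.rclikeToReal ℂ E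
  obtain ⟨p, hp, hmin⟩ := exists_norm_eq_iInf_of_complete_convex hne hc.isComplete hconv 0
  rw [norm_eq_iInf_iff_real_inner_le_zero hconv hp] at hmin
  refine ⟨p, hp, fun w hw => ?_⟩
  have h1 := hmin w hw
  rw [zero_sub, inner_neg_left, inner_sub_right, real_inner_self_eq_norm_sq,
    real_inner_eq_re_inner ℂ] at h1
  simp only [RCLike.re_eq_complex_re] at h1
  linarith

/-- The orthogonal projection of `x` to the invariant vectors lies in every closed convex invariant
set that contains `x`. -/
theorem mem_of_isClosed_convex_invariant {σ : UnitaryRep.{u, w} Γ} {K : Set σ.H}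
    (hc : IsClosed K) (hconv : Convex ℝ K) (hinv : ∀ γ, ∀ x ∈ K, σ.toHom γ x ∈ K)
    {x y : σ.H} (hx : x ∈ K) (hy : y ∈ σ.invariants) (hxy : x - y ∈ (σ.invariants)ᗮ) : y ∈ K := by
  -- The vectors of `K` with the same projection to the invariants as `x`. The element of least norm
  -- in this closed convex invariant set is fixed by the group, hence equals that projection.
  set K' : Set σ.H := K ∩ {η | ∀ u ∈ σ.invariants, inner ℂ u η = inner ℂ u x} with hK'
  have hc' : IsClosed K' := by
    refine hc.inter ?_
    simp only [Set.ofPred_forall]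
    exact isClosed_iInter fun u => isClosed_iInter fun _ => isClosed_eq (by fun_prop) (by fun_prop)
  have hconv' : Convex ℝ K' := by
    refine hconv.inter ?_
    intro a ha b hb s t _ _ hst u hu
    rw [inner_add_right, ← Complex.coe_smul, ← Complex.coe_smul, inner_smul_right,
      inner_smul_right, ha u hu, hb u hu, ← add_mul, ← Complex.ofReal_add, hst]
    simp
  have hinv' : ∀ γ, ∀ η ∈ K', σ.toHom γ η ∈ K' := fun γ η hη =>
    ⟨hinv γ η hη.1, fun u hu => by
      rw [← hη.2 u hu, ← (σ.toHom γ).inner_map_map u η, hu γ]⟩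
  obtain ⟨p, hp, hmin⟩ :=
    exists_minimal_of_isClosed_convex (K := K') ⟨x, hx, fun _ _ => rfl⟩ hc' hconv'
  have hpinv : p ∈ σ.invariants := by
    intro γ
    have h1 := hmin _ (hinv' γ p hp)
    have h2 := σ.norm_toHom_sub_sq γ p
    have h3 : ‖σ.toHom γ p - p‖ ^ 2 ≤ 0 := by linarith
    have h4 : ‖σ.toHom γ p - p‖ = 0 := by nlinarith [norm_nonneg (σ.toHom γ p - p)]
    exact sub_eq_zero.mp (norm_eq_zero.mp h4)
  have hpy : p = y := by
    have hd : p - y ∈ σ.invariants := Submodule.sub_mem _ hpinv hy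
    have h1 := (Submodule.mem_orthogonal _ _).mp hxy _ hd
    have h2 := hp.2 _ hd
    rw [inner_sub_right, sub_eq_zero, ← h2, ← sub_eq_zero, ← inner_sub_right] at h1
    exact sub_eq_zero.mp (inner_self_eq_zero.mp h1)
  exact hpy ▸ hp.1

/-- The form is the inner product of a vector with its right translate by `k`, which has the same
norm; Cauchy–Schwarz applies. -/
theorem IsGNSVector.norm_quadForm_coeff_le {φ : Γ → ℂ} {v : π.H} (h : IsGNSVector φ π v)
    (hφ : φ ∈ traces Γ) (k : Γ) {n : ℕ} (g : Fin n → Γ) (α : Fin n → ℂ) :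
    ‖quadForm (fun γ => inner ℂ (π.toHom k v) (π.toHom γ v)) g α‖ ≤ (quadForm φ g α).re := by
  have h1 : quadForm (fun γ => inner ℂ (π.toHom k v) (π.toHom γ v)) g α =
      inner ℂ (∑ i, α i • π.toHom (g i * k) v) (∑ i, α i • π.toHom (g i) v) := by
    simp only [sum_inner, inner_sum, inner_smul_left, inner_smul_right, h.inner_eq, quadForm,
      Finset.mul_sum]
    refine Finset.sum_congr rfl fun i _ => Finset.sum_congr rfl fun j _ => ?_
    rw [mul_inv_rev, mul_assoc k⁻¹]; ring
  rw [h1, h.quadForm_eq, Complex.ofReal_re]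
  refine (norm_inner_le_norm _ _).trans ?_
  rw [h.norm_sum_translate hφ, sq]

/-- For a character, the only invariant vectors of the conjugation representation are the multiples
of the cyclic vector. -/
theorem IsGNSVector.eq_smul_of_mem_invariants {φ : Γ → ℂ} {v : π.H} (h : IsGNSVector φ π v)
    (hφ : φ ∈ characters Γ) {c : Γ →* (π.H ≃ₗᵢ[ℂ] π.H)}
    (hc : ∀ g k, c g (π.toHom k v) = π.toHom (g * k * g⁻¹) v) {x : π.H}
    (hx : x ∈ (π.withHom c).invariants) : x = (inner ℂ v x : ℂ) • v := by
  have htr : φ ∈ traces Γ := extremePoints_subset hφ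
  have hv : ‖v‖ = 1 := h.norm_eq_one htr
  have hvv : inner ℂ v v = 1 := by rw [inner_self_eq_norm_sq_to_K, hv]; simp
  have hvinv : v ∈ (π.withHom c).invariants := fun γ => by
    have := hc γ 1
    simpa using this
  have hcinner : ∀ (k γ : Γ) (η : π.H), inner ℂ (c k η) (π.toHom γ v) =
      inner ℂ η (π.toHom (k⁻¹ * γ * k) v) := by
    intro k γ η
    have := inner_toHom_left (π.withHom c) k η (π.toHom γ v)
    rw [this, hc, inv_inv]
  -- The vectors whose coefficient against the orbit of `v` is dominated by φ: a closed convex set,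
  -- invariant under conjugation, containing every translate of `v`.
  set K : Set π.H := {η | ∀ (n : ℕ) (g : Fin n → Γ) (α : Fin n → ℂ),
    ‖quadForm (fun γ => inner ℂ η (π.toHom γ v)) g α‖ ≤ (quadForm φ g α).re} with hK
  have hKc : IsClosed K := by
    simp only [hK, Set.ofPred_forall]
    refine isClosed_iInter fun n => isClosed_iInter fun g => isClosed_iInter fun α =>
      isClosed_le ?_ continuous_const
    unfold quadForm
    fun_prop
  have hKconv : Convex ℝ K := by
    intro a ha b hb s t hs ht hst n g α
    have h1 : quadForm (fun γ => inner ℂ (s • a + t • b) (π.toHom γ v)) g α =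
        (s : ℂ) * quadForm (fun γ => inner ℂ a (π.toHom γ v)) g α +
          (t : ℂ) * quadForm (fun γ => inner ℂ b (π.toHom γ v)) g α := by
      rw [← quadForm_const_mul, ← quadForm_add_smul]
      congr 1
      ext γ
      rw [inner_add_left, ← Complex.coe_smul, ← Complex.coe_smul, inner_smul_left,
        inner_smul_left, Complex.conj_ofReal, Complex.conj_ofReal]
    rw [h1]
    refine (norm_add_le _ _).trans ?_
    rw [norm_mul, norm_mul, Complex.norm_real, Complex.norm_real, Real.norm_of_nonneg hs,
      Real.norm_of_nonneg ht]
    calc _ ≤ s * (quadForm φ g α).re + t * (quadForm φ g α).re := by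
          gcongr
          · exact ha n g α
          · exact hb n g α
      _ = (quadForm φ g α).re := by rw [← add_mul, hst, one_mul]
  have hKinv : ∀ k, ∀ η ∈ K, (π.withHom c).toHom k η ∈ K := by
    intro k η hη n g α
    have h1 : quadForm (fun γ => inner ℂ (c k η) (π.toHom γ v)) g α =
        quadForm (fun γ => inner ℂ η (π.toHom γ v)) (fun i => k⁻¹ * g i * k) α := by
      simp only [quadForm, hcinner]
      refine Finset.sum_congr rfl fun i _ => Finset.sum_congr rfl fun j _ => ?_
      congr 3; group
    have h2 : quadForm φ g α = quadForm φ (fun i => k⁻¹ * g i * k) α := by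
      simp only [quadForm]
      refine Finset.sum_congr rfl fun i _ => Finset.sum_congr rfl fun j _ => ?_
      rw [← htr.2.1 _ k]
      congr 2; group
    change ‖quadForm (fun γ => inner ℂ (c k η) (π.toHom γ v)) g α‖ ≤ _
    rw [h1, h2]
    exact hη _ _ _
  -- The projection of a translate of `v` to the invariants stays in `K`; its coefficient function
  -- is conjugation-invariant and dominated, hence a multiple of φ by extremality.
  have hproj : ∀ k, ∃ a : ℂ, π.toHom k v - a • v ∈ (π.withHom c).invariantsᗮ := by
    intro k
    obtain ⟨y, hy, z, hz, hyz⟩ :=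
      (π.withHom c).invariants.exists_add_mem_mem_orthogonal (π.toHom k v)
    have hyK : y ∈ K := mem_of_isClosed_convex_invariant (σ := π.withHom c) hKc hKconv hKinv
      (x := π.toHom k v) (fun n g α => h.norm_quadForm_coeff_le htr k g α) hy
      (by rw [hyz]; simpa using hz)
    have h1 := eq_smul_of_dominated hφ (f := fun γ => inner ℂ y (π.toHom γ v)) (C := 1)
      (fun γ g => by
        have := hcinner g γ y
        rw [show c g y = y from hy g] at this
        exact this.symm) one_pos
      (fun n g α => by rw [one_mul]; exact hyK n g α)
    refine ⟨inner ℂ v y, ?_⟩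
    have h2 : y - (inner ℂ v y : ℂ) • v = 0 := eq_zero_of_inner_family_eq_zero h.1 fun γ => by
      have := h1 γ
      simp only [toHom_one_apply, h.2] at this
      rw [inner_sub_left, inner_smul_left, this, inner_conj_symm, sub_self]
    rw [← sub_eq_zero.mp h2, hyz]
    simpa using hz
  -- This difference is invariant and orthogonal to `v`, while each translate of `v` is a multiple
  -- of `v` plus a vector orthogonal to the invariants.
  have h0 : x - (inner ℂ v x : ℂ) • v = 0 := eq_zero_of_inner_family_eq_zero h.1 fun k => by
    obtain ⟨a, ha⟩ := hproj k
    have hx0 : x - (inner ℂ v x : ℂ) • v ∈ (π.withHom c).invariants :=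
      Submodule.sub_mem _ hx (Submodule.smul_mem _ _ hvinv)
    have h1 := (Submodule.mem_orthogonal _ _).mp ha _ hx0
    have h2 : inner ℂ (x - (inner ℂ v x : ℂ) • v) (a • v) = 0 := by
      rw [inner_smul_right, inner_sub_left, inner_smul_left, hvv, inner_conj_symm]; simp
    rw [inner_sub_right] at h1
    exact (sub_eq_zero.mp h1).trans h2
  exact sub_eq_zero.mp h0

end UnitaryRep

/-! ### The GNS construction -/

section GNS

variable {Γ : Type u} [Group Γ]

/-- The function `γ ↦ ⟪x, c(γ) x⟫`, where `c` is the conjugation representation attached to `φ`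
and `x` is the vector with coefficients `a`. -/
noncomputable def conjForm (a : Γ →₀ ℂ) (γ : Γ) (φ : Γ → ℂ) : ℂ :=
  ∑ i ∈ a.support, ∑ j ∈ a.support,
    (starRingEnd ℂ) (a i) * a j * φ (i⁻¹ * (γ * j * γ⁻¹))

theorem continuous_conjForm (a : Γ →₀ ℂ) (γ : Γ) : Continuous (conjForm a γ) := by
  unfold conjForm
  fun_prop

theorem conjForm_one_re_nonneg {φ : Γ → ℂ} (hφ : IsPositiveDefinite φ) (a : Γ →₀ ℂ) :
    0 ≤ (conjForm a 1 φ).re := by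
  set e := a.support.equivFin
  have key : ∀ F : Γ → ℂ, ∑ k, F (e.symm k) = ∑ i ∈ a.support, F i := fun F => by
    rw [← Finset.sum_coe_sort a.support]
    exact Equiv.sum_comp e.symm fun i : a.support => F i
  have h := (hφ _ (fun k => ((e.symm k : a.support) : Γ)) (fun k => a (e.symm k : a.support))).1
  convert h using 2
  calc conjForm a 1 φ = ∑ j ∈ a.support, ∑ i ∈ a.support,
        a j * (starRingEnd ℂ) (a i) * φ (i⁻¹ * j) := by
        rw [conjForm, Finset.sum_comm]
        refine Finset.sum_congr rfl fun i _ => Finset.sum_congr rfl fun j _ => ?_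
        rw [one_mul, inv_one, mul_one, mul_comm (a i)]
    _ = ∑ k, ∑ i ∈ a.support,
        a (e.symm k) * (starRingEnd ℂ) (a i) * φ (i⁻¹ * e.symm k) := (key fun j =>
          ∑ i ∈ a.support, a j * (starRingEnd ℂ) (a i) * φ (i⁻¹ * j)).symm
    _ = _ := Finset.sum_congr rfl fun k _ =>
      (key fun i => a (e.symm k) * (starRingEnd ℂ) (a i) * φ (i⁻¹ * e.symm k)).symm

/-- Finitely supported functions carry the semi-inner product given by φ, and completion also
removes its null vectors. -/
theorem exists_family_of_isPositiveDefinite {φ : Γ → ℂ} (hφ : IsPositiveDefinite φ) :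
    ∃ (E : Type u) (_ : NormedAddCommGroup E) (_ : InnerProductSpace ℂ E) (_ : CompleteSpace E)
      (a : Γ → E), (Submodule.span ℂ (Set.range a)).topologicalClosure = ⊤ ∧
        ∀ i j, inner ℂ (a i) (a j) = φ (i⁻¹ * j) := by
  let core : PreInnerProductSpace.Core ℂ (Γ →₀ ℂ) :=
    { inner := fun f g => f.sum fun i z => g.sum fun j w => (starRingEnd ℂ) z * w * φ (i⁻¹ * j)
      conj_inner_symm := fun f g => by
        simp only [Finsupp.sum, map_sum, map_mul, Complex.conj_conj, ← hφ.apply_inv, mul_inv_rev,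
          inv_inv]
        rw [Finset.sum_comm]
        refine Finset.sum_congr rfl fun i _ => Finset.sum_congr rfl fun j _ => ?_
        ring
      add_left := fun f g k => by
        rw [Finsupp.sum_add_index'] <;> simp [← Finsupp.sum_add, add_mul]
      smul_left := fun f g r => by
        rw [Finsupp.sum_smul_index] <;> simp [Finsupp.mul_sum, ← mul_assoc]
      re_inner_nonneg := fun f => by
        have := conjForm_one_re_nonneg hφ f
        simpa [conjForm, Finsupp.sum] using this }
  let _ : SeminormedAddCommGroup (Γ →₀ ℂ) :=
    InnerProductSpace.Core.toSeminormedAddCommGroup (𝕜 := ℂ)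
  let _ : InnerProductSpace ℂ (Γ →₀ ℂ) := .ofCore _
  have hinner : ∀ f g : Γ →₀ ℂ, inner ℂ f g =
    f.sum fun i z => g.sum fun j w => (starRingEnd ℂ) z * w * φ (i⁻¹ * j) := fun _ _ => rfl
  refine ⟨UniformSpace.Completion (Γ →₀ ℂ), inferInstance, inferInstance, inferInstance,
    fun i => ((Finsupp.single i 1 : Γ →₀ ℂ) : UniformSpace.Completion (Γ →₀ ℂ)), ?_, ?_⟩
  · rw [← Submodule.dense_iff_topologicalClosure_eq_top]
    refine UniformSpace.Completion.denseRange_coe.mono ?_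
    rintro _ ⟨f, rfl⟩
    induction f using Finsupp.induction_linear with
    | zero => 
      rw [UniformSpace.Completion.coe_zero]
      exact Submodule.zero_mem _
    | add f g hf hg => rw [UniformSpace.Completion.coe_add]; exact Submodule.add_mem _ hf hg
    | single i z =>
      have : Finsupp.single i z = z • Finsupp.single i (1 : ℂ) := by simp
      rw [this, UniformSpace.Completion.coe_smul]
      exact Submodule.smul_mem _ _ (Submodule.subset_span ⟨i, rfl⟩)
  · intro i j
    rw [UniformSpace.Completion.inner_coe, hinner]
    simp

end GNS

namespace UnitaryRep

variable {Γ : Type u} [Group Γ]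

/-- Serves only as an auxiliary realization in testing extremality. It need not belong to `R`, so
its universe is independent of that of `R`. -/
theorem exists_isGNSVector {φ : Γ → ℂ} (hφ : IsPositiveDefinite φ) :
    ∃ (π : UnitaryRep.{u, u} Γ) (v : π.H), IsGNSVector φ π v := by
  obtain ⟨E, _, _, _, a, hd, ha⟩ := exists_family_of_isPositiveDefinite hφ
  obtain ⟨ρ, hρ⟩ := exists_unitary_hom_of_inner_eq (MulAction.toPermHom Γ Γ) hd (fun g i j => by
    rw [ha, ha]
    congr 1
    simp [mul_assoc])
  have h1 : ∀ γ, ρ γ (a 1) = a γ := fun γ => by rw [hρ]; simp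
  refine ⟨⟨E, ρ⟩, a 1, ?_, fun γ => ?_⟩
  · simpa only [h1] using hd
  · simp only [h1, ha]; simp

namespace IsGNSVector

variable {φ : Γ → ℂ} {π : UnitaryRep.{u, w} Γ} {v : π.H}

theorem inner_conj (h : IsGNSVector φ π v) {c : Γ →* (π.H ≃ₗᵢ[ℂ] π.H)}
    (hc : ∀ g k, c g (π.toHom k v) = π.toHom (g * k * g⁻¹) v) (a : Γ →₀ ℂ) (γ : Γ) :
    inner ℂ (Finsupp.linearCombination ℂ (fun g => π.toHom g v) a)
      (c γ (Finsupp.linearCombination ℂ (fun g => π.toHom g v) a)) = conjForm a γ φ := by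
  simp only [Finsupp.linearCombination_apply, Finsupp.sum, map_sum, map_smul, hc, sum_inner,
    inner_sum, inner_smul_left, inner_smul_right, h.inner_eq, conjForm, Finset.mul_sum]
  rw [Finset.sum_comm]
  refine Finset.sum_congr rfl fun i _ => Finset.sum_congr rfl fun j _ => ?_
  ring

theorem norm_sq_eq (h : IsGNSVector φ π v) (a : Γ →₀ ℂ) :
    ‖Finsupp.linearCombination ℂ (fun g => π.toHom g v) a‖ ^ 2 = (conjForm a 1 φ).re := by
  rw [← inner_self_eq_norm_sq (𝕜 := ℂ)]
  simp only [Finsupp.linearCombination_apply, Finsupp.sum, sum_inner,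
    inner_sum, inner_smul_left, inner_smul_right, h.inner_eq, conjForm, Finset.mul_sum,
    RCLike.re_eq_complex_re]
  rw [Finset.sum_comm]
  congr 1
  refine Finset.sum_congr rfl fun i _ => Finset.sum_congr rfl fun j _ => ?_
  simp; ring

theorem inner_vector (h : IsGNSVector φ π v) (a : Γ →₀ ℂ) :
    inner ℂ v (Finsupp.linearCombination ℂ (fun g => π.toHom g v) a) =
      ∑ i ∈ a.support, a i * φ i := by
  simp only [Finsupp.linearCombination_apply, Finsupp.sum, inner_sum, inner_smul_right, h.2]

end IsGNSVector

/-! ### The conjugation gap: a closed condition that forces extremality. -/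

theorem norm_sub_inner_smul_sq {E : Type*} [NormedAddCommGroup E] [InnerProductSpace ℂ E] {v : E}
    (hv : ‖v‖ = 1) (x : E) :
    ‖x - (inner ℂ v x : ℂ) • v‖ ^ 2 = ‖x‖ ^ 2 - ‖(inner ℂ v x : ℂ)‖ ^ 2 := by
  rw [norm_sub_sq (𝕜 := ℂ), norm_smul, hv, inner_smul_right, ← inner_conj_symm x v,
    RCLike.mul_conj]
  simp only [mul_one, RCLike.re_eq_complex_re]
  have : ((‖(inner ℂ v x : ℂ)‖ : ℂ) ^ 2).re = ‖(inner ℂ v x : ℂ)‖ ^ 2 := by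
    rw [← Complex.ofReal_pow, Complex.ofReal_re]
  erw [this]
  ring

/-- The spectral gap of the conjugation representation away from the cyclic vector, as an inequality
for `φ`. -/
def ConjGap (Q : Finset Γ) (ε : ℝ) (φ : Γ → ℂ) : Prop :=
  ∀ a : Γ →₀ ℂ, ε ^ 2 * ((conjForm a 1 φ).re - ‖∑ i ∈ a.support, a i * φ i‖ ^ 2) ≤
    ∑ γ ∈ Q, (2 * (conjForm a 1 φ).re - 2 * (conjForm a γ φ).re)

/-- For fixed `a` the inequality involves finitely many values of φ. This is why the gap is stated
on finite combinations of translates. -/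
theorem isClosed_conjGap (Q : Finset Γ) (ε : ℝ) : IsClosed {φ : Γ → ℂ | ConjGap Q ε φ} := by
  simp only [ConjGap, Set.ofPred_forall]
  have := fun (a : Γ →₀ ℂ) (γ : Γ) => continuous_conjForm a γ
  exact isClosed_iInter fun a => isClosed_le (by fun_prop) (by fun_prop)

/-- Since the invariant vectors are the multiples of `v`, subtracting the component along `v` lands
in their orthogonal complement, and it leaves displacements unchanged because `v` is fixed. -/
theorem IsGNSVector.conjGap {φ : Γ → ℂ} {π : UnitaryRep.{u, w} Γ} {v : π.H}
    (h : IsGNSVector φ π v) (hφ : φ ∈ characters Γ) {c : Γ →* (π.H ≃ₗᵢ[ℂ] π.H)}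
    (hc : ∀ g k, c g (π.toHom k v) = π.toHom (g * k * g⁻¹) v) {Q : Finset Γ} {ε : ℝ}
    (hgap : HasGap Q ε (π.withHom c)) : ConjGap Q ε φ := by
  intro a
  set x := Finsupp.linearCombination ℂ (fun g => π.toHom g v) a with hx
  have hv : ‖v‖ = 1 := h.norm_eq_one (extremePoints_subset hφ)
  have hcv : ∀ g, c g v = v := fun g => by simpa using hc g 1
  have hz : x - (inner ℂ v x : ℂ) • v ∈ (π.withHom c).invariantsᗮ := by
    rw [Submodule.mem_orthogonal]
    intro u hu
    have hu' := h.eq_smul_of_mem_invariants hφ hc hu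
    rw [hu']
    change inner ℂ ((inner ℂ v u : ℂ) • v) (x - (inner ℂ v x : ℂ) • v) = 0
    rw [inner_smul_left, inner_sub_right, inner_smul_right, inner_self_eq_norm_sq_to_K, hv]
    simp
  have h1 := hgap _ hz
  have h3 : ∀ γ, ‖c γ (x - (inner ℂ v x : ℂ) • v) - (x - (inner ℂ v x : ℂ) • v)‖ ^ 2 =
      2 * (conjForm a 1 φ).re - 2 * (conjForm a γ φ).re := by
    intro γ
    rw [map_sub, map_smul, hcv, sub_sub_sub_cancel_right]
    have := norm_toHom_sub_sq (π.withHom c) γ x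
    rw [this, h.norm_sq_eq, h.inner_conj hc]
  rw [← h.norm_sq_eq, ← h.inner_vector, ← hx, ← norm_sub_inner_smul_sq hv, hx, h.norm_sq_eq]
  exact h1.trans (Finset.sum_le_sum fun γ _ => (h3 γ).le)

/-- The gap extends by density to the GNS space and leaves only multiples of `v` invariant. A
summand φ₁ of φ is represented by an invariant vector (a Radon–Nikodym derivative), hence is
proportional, and so equal, to φ. -/
theorem ConjGap.mem_characters {φ : Γ → ℂ} (hφ : φ ∈ traces Γ) {Q : Finset Γ} {ε : ℝ}
    (hε : 0 < ε) (hgap : ConjGap Q ε φ) : φ ∈ characters Γ := by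
  obtain ⟨π, v, h⟩ := exists_isGNSVector hφ.1
  obtain ⟨ρ, hρ⟩ := h.exists_biHom hφ
  set c : Γ →* (π.H ≃ₗᵢ[ℂ] π.H) := ρ.comp ((MonoidHom.id Γ).prod (MonoidHom.id Γ)) with hcdef
  have hc : ∀ g k, c g (π.toHom k v) = π.toHom (g * k * g⁻¹) v := fun g k => hρ (g, g) k
  have hv : ‖v‖ = 1 := h.norm_eq_one hφ
  have hall : ∀ x : π.H, ε ^ 2 * (‖x‖ ^ 2 - ‖(inner ℂ v x : ℂ)‖ ^ 2) ≤
      ∑ γ ∈ Q, ‖c γ x - x‖ ^ 2 := by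
    intro x
    induction x using (denseRange_linearCombination h.1).induction_on with
    | hp => exact isClosed_le (by fun_prop) (by fun_prop)
    | ih a =>
      rw [h.norm_sq_eq, h.inner_vector]
      refine (hgap a).trans (Finset.sum_le_sum fun γ _ => ?_)
      have := norm_toHom_sub_sq (π.withHom c) γ
        (Finsupp.linearCombination ℂ (fun g => π.toHom g v) a)
      rw [this, h.norm_sq_eq, h.inner_conj hc]
  have hinv : ∀ x : π.H, (∀ γ, c γ x = x) → x = (inner ℂ v x : ℂ) • v := by
    intro x hx
    have h1 := hall x
    simp only [hx, sub_self, norm_zero] at h1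
    rw [← norm_sub_inner_smul_sq hv] at h1
    have h2 : ‖x - (inner ℂ v x : ℂ) • v‖ ^ 2 ≤ 0 := by
      by_contra! hcon
      have := mul_pos (pow_pos hε 2) hcon
      simp at h1
      linarith
    have h3 : ‖x - (inner ℂ v x : ℂ) • v‖ = 0 := by
      nlinarith [norm_nonneg (x - (inner ℂ v x : ℂ) • v)]
    exact sub_eq_zero.mp (norm_eq_zero.mp h3)
  refine mem_extremePoints_iff_left.mpr ⟨hφ, ?_⟩
  rintro φ₁ hφ₁ φ₂ hφ₂ ⟨s, t, hs, ht, hst, rfl⟩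
  obtain ⟨π₁, v₁, h₁⟩ := exists_isGNSVector hφ₁.1
  -- Domination s φ₁ ≤ φ makes the map sending translates of `v` to those of `v₁` bounded; its
  -- adjoint at `v₁` is the derivative.
  have hbound : ∀ a : Γ →₀ ℂ, ‖Finsupp.linearCombination ℂ (fun g => π₁.toHom g v₁) a‖ ≤
      (Real.sqrt s)⁻¹ * ‖Finsupp.linearCombination ℂ (fun g => π.toHom g v) a‖ := by
    intro a
    rw [inv_mul_eq_div, le_div_iff₀ (Real.sqrt_pos.mpr hs),
      ← sq_le_sq₀ (by positivity) (by positivity), mul_pow, Real.sq_sqrt hs.le, h₁.norm_sq_eq,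
      h.norm_sq_eq]
    have e : conjForm a 1 (s • φ₁ + t • φ₂) =
        (s : ℂ) * conjForm a 1 φ₁ + (t : ℂ) * conjForm a 1 φ₂ := by
      simp only [conjForm, Finset.mul_sum, ← Finset.sum_add_distrib, Pi.add_apply, Pi.smul_apply,
        Complex.real_smul]
      refine Finset.sum_congr rfl fun i _ => Finset.sum_congr rfl fun j _ => ?_
      ring
    rw [e, Complex.add_re, Complex.re_ofReal_mul, Complex.re_ofReal_mul]
    nlinarith [mul_nonneg ht.le (conjForm_one_re_nonneg hφ₂.1 a)]
  let T := (Finsupp.linearCombination ℂ (fun g => π₁.toHom g v₁)).extendOfNorm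
    (Finsupp.linearCombination ℂ (fun g => π.toHom g v))
  have hT : ∀ g, T (π.toHom g v) = π₁.toHom g v₁ := fun g => by
    simpa using LinearMap.extendOfNorm_eq (denseRange_linearCombination h.1) ⟨_, hbound⟩
      (Finsupp.single g 1)
  set η : π.H := T.adjoint v₁ with hη
  have hηg : ∀ g, inner ℂ η (π.toHom g v) = φ₁ g := fun g => by
    rw [hη, ContinuousLinearMap.adjoint_inner_left, hT, h₁.2]
  have hηinv : ∀ γ, c γ η = η := fun γ => by
    rw [← sub_eq_zero]
    refine eq_zero_of_inner_family_eq_zero h.1 fun g => ?_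
    have := inner_toHom_left (π.withHom c) γ η (π.toHom g v)
    rw [inner_sub_left, this, hc, hηg, hηg, inv_inv, hφ₁.2.1, sub_self]
  have hη' := hinv η hηinv
  have hφ₁g : ∀ g, φ₁ g = (starRingEnd ℂ) (inner ℂ v η) * (s • φ₁ + t • φ₂) g := fun g => by
    rw [← hηg, hη', inner_smul_left, ← h.2, ← hη']
  have hone := hφ₁g 1
  rw [hφ₁.2.2, hφ.2.2, mul_one] at hone
  ext g
  rw [hφ₁g, ← hone, one_mul]

end UnitaryRep

theorem isClosed_traces (Γ : Type u) [Group Γ] : IsClosed (traces Γ) := by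
  have h1 : IsClosed {φ : Γ → ℂ | IsPositiveDefinite φ} := by
    simp only [isPositiveDefinite_iff, Set.ofPred_forall, Set.ofPred_and]
    refine isClosed_iInter fun n => isClosed_iInter fun g => isClosed_iInter fun α => ?_
    have hc : Continuous fun φ : Γ → ℂ => quadForm φ g α := by unfold quadForm; fun_prop
    exact (isClosed_le (by fun_prop) (by fun_prop)).inter (isClosed_eq (by fun_prop) (by fun_prop))
  have h2 : IsClosed {φ : Γ → ℂ | ∀ γ x, φ (x⁻¹ * γ * x) = φ γ} := by
    simp only [Set.ofPred_forall]
    exact isClosed_iInter fun γ => isClosed_iInter fun x => isClosed_eq (by fun_prop) (by fun_prop)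
  exact h1.inter (h2.inter (isClosed_eq (by fun_prop) continuous_const))

/-! ### Finite-dimensional spectral subspaces -/

section Spectral

variable {E : Type*} [NormedAddCommGroup E] [InnerProductSpace ℂ E]

theorem finiteDimensional_of_finrank_le {W : Submodule ℂ E} {C : ℝ}
    (h : ∀ V : Submodule ℂ E, V ≤ W → FiniteDimensional ℂ V → (Module.finrank ℂ V : ℝ) ≤ C) :
    FiniteDimensional ℂ W := by
  by_contra hW
  rw [FiniteDimensional, ← Module.rank_lt_aleph0_iff, not_lt] at hW
  obtain ⟨n, hn⟩ := exists_nat_gt C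
  obtain ⟨s, hs, hli⟩ := le_rank_iff_exists_linearIndependent_finset.mp
    ((Cardinal.natCast_le_aleph0 (n := n)).trans hW)
  have hli' := hli.map' W.subtype W.ker_subtype
  have hfin : FiniteDimensional ℂ
      (Submodule.span ℂ (Set.range (W.subtype ∘ fun x : (s : Set W) => (x : W)))) :=
    FiniteDimensional.span_of_finite ℂ (Set.finite_range _)
  have h1 := h _ (Submodule.span_le.mpr (by rintro _ ⟨x, rfl⟩; exact (x : W).2)) hfin
  rw [finrank_span_eq_card hli'] at h1
  simp [hs] at h1
  linarith

variable [CompleteSpace E]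

/-- An operator with finite Hilbert–Schmidt norm has a finite-dimensional spectral subspace which is
invariant under all unitary operators commuting with it. -/
theorem exists_finiteDimensional_invariant {G : Type*} [Group G] (ρ : G →* (E ≃ₗᵢ[ℂ] E))
    {T : E →L[ℂ] E} (hT : T ≠ 0) (hcomm : ∀ g x, T (ρ g x) = ρ g (T x)) {M : ℝ}
    (hM : ∀ (k : ℕ) (e : Fin k → E), Orthonormal ℂ e → ∑ i, ‖T (e i)‖ ^ 2 ≤ M) :
    ∃ W : Submodule ℂ E, W ≠ ⊥ ∧ (∀ g, ∀ x ∈ W, ρ g x ∈ W) ∧ FiniteDimensional ℂ W ∧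
      Module.finrank ℂ W * ‖T‖ ^ 2 ≤ 2 * M := by
  obtain ⟨x₀, hx₀⟩ : ∃ x, T x ≠ 0 := by
    by_contra! h
    exact hT (ContinuousLinearMap.ext h)
  have : Nontrivial E := ⟨x₀, 0, fun h => hx₀ (by rw [h, map_zero])⟩
  set A : E →L[ℂ] E := star T * T with hA
  have hA0 : 0 ≤ A := star_mul_self_nonneg T
  have hAsa : IsSelfAdjoint A := .of_nonneg hA0
  have hnorm : ‖A‖ = ‖T‖ ^ 2 := by rw [hA, CStarRing.norm_star_mul_self, sq]
  have hTpos : 0 < ‖T‖ := norm_pos_iff.mpr hT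
  set b : ℝ := ‖T‖ ^ 2 with hb
  have hb0 : 0 < b := by positivity
  -- A continuous substitute for the spectral projection of A = T*T above half of its norm.
  let f : ℝ → ℝ := fun t => max (t - b / 2) 0
  have hf : Continuous f := by fun_prop
  set F : E →L[ℂ] E := cfc f A with hF
  have hFsa : IsSelfAdjoint F := cfc_predicate f A
  -- The norm b of the positive operator A is in its spectrum, and f(b) = b/2 is not zero.
  have hFne : F ≠ 0 := by
    intro h0
    have h1 : f b ∈ spectrum ℝ F := by
      rw [hF, cfc_map_spectrum f A hAsa hf.continuousOn]
      exact ⟨b, hnorm ▸ CStarAlgebra.norm_mem_spectrum_of_nonneg hA0, rfl⟩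
    rw [h0, spectrum.zero_eq, Set.mem_singleton_iff] at h1
    have h2 : b - b / 2 ≤ f b := le_max_left _ _
    linarith
  have hpos : 0 ≤ F * (A - algebraMap ℝ _ (b / 2)) * F := by
    have e : F * (A - algebraMap ℝ _ (b / 2)) * F = cfc (fun t => f t * (t - b / 2) * f t) A := by
      rw [cfc_mul (fun t => f t * (t - b / 2)) f A (by fun_prop) hf.continuousOn,
        cfc_mul f (fun t => t - b / 2) A hf.continuousOn (by fun_prop),
        cfc_sub (fun t => t) (fun _ => b / 2) A (by fun_prop) (by fun_prop),
        cfc_id' ℝ A hAsa, cfc_const _ A hAsa]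
    rw [e]
    refine cfc_nonneg fun t _ => ?_
    by_cases ht : t - b / 2 ≤ 0
    · simp [f, max_eq_right ht]
    · push Not at ht
      have : 0 ≤ f t := le_max_right _ _
      positivity
  have hlow : ∀ y, b / 2 * ‖F y‖ ^ 2 ≤ ‖T (F y)‖ ^ 2 := by
    intro y
    rw [ContinuousLinearMap.nonneg_iff_isPositive] at hpos
    have h1 := hpos.re_inner_nonneg_right y
    have hFadj : ∀ z, inner ℂ y (F z) = inner ℂ (F y) z := fun z => by
      rw [← ContinuousLinearMap.adjoint_inner_right]
      congr 2
      exact hFsa.symm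
    have h2 : inner ℂ y ((F * (A - algebraMap ℝ _ (b / 2)) * F) y) =
        inner ℂ (T (F y)) (T (F y)) - ((b / 2 : ℝ) : ℂ) * inner ℂ (F y) (F y) := by
      change inner ℂ y (F (star T (T (F y)) - (algebraMap ℝ (E →L[ℂ] E) (b / 2)) (F y))) = _
      rw [hFadj, inner_sub_right, ContinuousLinearMap.star_eq_adjoint,
        ContinuousLinearMap.adjoint_inner_right, Algebra.algebraMap_eq_smul_one,
        smul_apply, one_apply_eq_self, ← Complex.coe_smul,
        inner_smul_right]
    rw [h2, map_sub, inner_self_eq_norm_sq, RCLike.re_eq_complex_re, Complex.re_ofReal_mul,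
      ← RCLike.re_eq_complex_re, inner_self_eq_norm_sq] at h1
    linarith
  -- Each vector of an orthonormal basis of `V` contributes at least b/2 to the Hilbert–Schmidt sum.
  have hdim : ∀ V : Submodule ℂ E, V ≤ F.range → FiniteDimensional ℂ V →
      (Module.finrank ℂ V : ℝ) * b ≤ 2 * M := by
    intro V hV _
    let e := stdOrthonormalBasis ℂ V
    have h1 := hM _ (fun i => ((e i : V) : E)) (e.orthonormal.comp_linearIsometry V.subtypeₗᵢ)
    have h2 : ∑ _i : Fin (Module.finrank ℂ V), b / 2 ≤ ∑ i, ‖T (e i : V)‖ ^ 2 :=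
      Finset.sum_le_sum fun i _ => by
        obtain ⟨y, hy⟩ := hV (e i).2
        have h3 := hlow y
        rw [show F y = (e i : E) from hy] at h3
        have h4 : ‖((e i : V) : E)‖ = 1 := e.orthonormal.1 i
        rwa [h4, one_pow, mul_one] at h3
    rw [Finset.sum_const, Finset.card_univ, Fintype.card_fin, nsmul_eq_mul] at h2
    linarith
  have hfin : FiniteDimensional ℂ F.range :=
    finiteDimensional_of_finrank_le (C := 2 * M / b) fun V hV hVf => by
      rw [le_div_iff₀ hb0]; exact hdim V hV hVf
  refine ⟨F.range, ?_, ?_, hfin, hdim _ le_rfl hfin⟩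
  · intro h
    apply hFne
    ext y
    have : F y ∈ F.range := ⟨y, rfl⟩
    rw [h] at this
    simpa using this
  · rintro g _ ⟨y, rfl⟩
    let U : E →L[ℂ] E := (ρ g).toLinearIsometry.toContinuousLinearMap
    have hUA : Commute A U := by
      ext x
      change star T (T (ρ g x)) = ρ g (star T (T x))
      rw [hcomm]
      refine ext_inner_left ℂ fun z => ?_
      have hadj : ∀ z y, inner ℂ z (ρ g y) = inner ℂ (ρ g⁻¹ z) y := fun z y => by
        rw [← (ρ g⁻¹).inner_map_map z (ρ g y)]
        congr 1
        change (ρ g⁻¹ * ρ g) y = y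
        rw [← map_mul]; simp
      rw [ContinuousLinearMap.star_eq_adjoint, ContinuousLinearMap.adjoint_inner_right, hadj, hadj,
        ContinuousLinearMap.adjoint_inner_right, hcomm]
    -- Being a function of A, the operator `F` commutes with everything that A commutes with, so its
    -- range is invariant.
    have hUF : Commute F U := hUA.cfc_real f
    exact ⟨ρ g y, congr($hUF.eq y)⟩

end Spectral

namespace UnitaryRep

variable {Γ : Type u} [Group Γ]

/-! ### Elementary tensors -/

/-- The elementary tensor `x ⊗ y`. -/
noncomputable def tvec (π ρ : UnitaryRep.{u, w} Γ) (x : π.H) (y : ρ.H) : (π.tensor ρ).H :=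
  ((x ⊗ₜ[ℂ] y : π.H ⊗[ℂ] ρ.H) : UniformSpace.Completion (π.H ⊗[ℂ] ρ.H))

variable (π ρ : UnitaryRep.{u, w} Γ)

theorem inner_tvec (x x' : π.H) (y y' : ρ.H) :
    inner ℂ (tvec π ρ x y) (tvec π ρ x' y') = inner ℂ x x' * inner ℂ y y' := by
  change inner ℂ ((x ⊗ₜ[ℂ] y : π.H ⊗[ℂ] ρ.H) : UniformSpace.Completion (π.H ⊗[ℂ] ρ.H))
    ((x' ⊗ₜ[ℂ] y' : π.H ⊗[ℂ] ρ.H) : UniformSpace.Completion (π.H ⊗[ℂ] ρ.H)) = _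
  rw [UniformSpace.Completion.inner_coe, TensorProduct.inner_tmul]

theorem norm_tvec (x : π.H) (y : ρ.H) : ‖tvec π ρ x y‖ = ‖x‖ * ‖y‖ := by
  change ‖((x ⊗ₜ[ℂ] y : π.H ⊗[ℂ] ρ.H) : UniformSpace.Completion (π.H ⊗[ℂ] ρ.H))‖ = _
  rw [UniformSpace.Completion.norm_coe, TensorProduct.norm_tmul]

theorem tensor_toHom_tvec (γ : Γ) (x : π.H) (y : ρ.H) :
    (π.tensor ρ).toHom γ (tvec π ρ x y) = tvec π ρ (π.toHom γ x) (ρ.toHom γ y) :=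
  tensor_apply π ρ γ x y

/-- The bilinear map `(x, y) ↦ x ⊗ y`. -/
noncomputable def tvecL : π.H →L[ℂ] ρ.H →L[ℂ] (π.tensor ρ).H :=
  (LinearMap.mk₂ ℂ (fun x y => tvec π ρ x y)
    (fun x x' y => by
      simp only [tvec, TensorProduct.add_tmul]; exact UniformSpace.Completion.coe_add _ _)
    (fun c x y => by
      simp only [tvec, ← TensorProduct.smul_tmul']; exact UniformSpace.Completion.coe_smul _ _)
    (fun x y y' => by
      simp only [tvec, TensorProduct.tmul_add]; exact UniformSpace.Completion.coe_add _ _)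
    (fun c x y => by
      simp only [tvec, TensorProduct.tmul_smul]
      exact UniformSpace.Completion.coe_smul _ _)).mkContinuous₂ 1
    fun x y => by simp [norm_tvec]

@[simp] theorem tvecL_apply (x : π.H) (y : ρ.H) : tvecL π ρ x y = tvec π ρ x y := rfl

theorem dense_span_tvec : (Submodule.span ℂ
    (Set.range fun p : π.H × ρ.H => tvec π ρ p.1 p.2)).topologicalClosure = ⊤ := by
  rw [← Submodule.dense_iff_topologicalClosure_eq_top]
  refine (UniformSpace.Completion.denseRange_coe (α := π.H ⊗[ℂ] ρ.H)).mono ?_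
  set K : Submodule ℂ (π.tensor ρ).H :=
    Submodule.span ℂ (Set.range fun p : π.H × ρ.H => tvec π ρ p.1 p.2) with hK
  rintro _ ⟨f, rfl⟩
  change _ ∈ K
  induction f using TensorProduct.induction_on with
  | zero => rw [UniformSpace.Completion.coe_zero]; exact K.zero_mem
  | tmul x y => rw [hK]; exact Submodule.mem_span_of_mem (s := Set.range fun p : π.H × ρ.H =>
      tvec π ρ p.1 p.2) ⟨(x, y), rfl⟩
  | add a b ha hb => rw [UniformSpace.Completion.coe_add]; exact K.add_mem ha hb

variable {π ρ}

/-- A vector of `π ⊗ ρ*` defines an operator. -/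
theorem exists_operator (S : (π.tensor ρ.dual).H) : ∃ T : ρ.H →L[ℂ] π.H,
    ∀ x y, inner ℂ x (T y) = inner ℂ (tvec π ρ.dual x (ρ.dualVec y)) S := by
  let t : ρ.H → π.H := fun y => ((tvecL π ρ.dual).flip (ρ.dualVec y)).adjoint S
  have ht : ∀ x y, inner ℂ x (t y) = inner ℂ (tvec π ρ.dual x (ρ.dualVec y)) S := fun x y => by
    simp only [t]
    rw [ContinuousLinearMap.adjoint_inner_right]; rfl
  have hb : ∀ y, ‖t y‖ ≤ ‖S‖ * ‖y‖ := fun y => by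
    have h1 : ‖t y‖ * ‖t y‖ ≤ ‖S‖ * ‖y‖ * ‖t y‖ := by
      rw [← inner_self_eq_norm_mul_norm (𝕜 := ℂ), ht]
      refine (RCLike.re_le_norm _).trans ((norm_inner_le_norm _ _).trans_eq ?_)
      rw [norm_tvec, norm_dualVec]; ring
    rcases (norm_nonneg (t y)).eq_or_lt with h0 | h0
    · rw [← h0]; positivity
    · exact le_of_mul_le_mul_right h1 h0
  refine ⟨LinearMap.mkContinuous
    { toFun := t
      map_add' := fun y z => ext_inner_left ℂ fun x => by
        rw [inner_add_right, ht, ht, ht, dualVec_add, ← tvecL_apply, map_add, inner_add_left]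
        rfl
      map_smul' := fun c y => ext_inner_left ℂ fun x => by
        rw [RingHom.id_apply, inner_smul_right, ht, ht, dualVec_smul, ← tvecL_apply, map_smul,
          inner_smul_left, Complex.conj_conj]
        rfl } ‖S‖ hb, ht⟩

theorem operator_comm {S : (π.tensor ρ.dual).H} (hS : S ∈ (π.tensor ρ.dual).invariants)
    {T : ρ.H →L[ℂ] π.H}
    (hT : ∀ x y, inner ℂ x (T y) = inner ℂ (tvec π ρ.dual x (ρ.dualVec y)) S) (γ : Γ) (y : ρ.H) :
    T (ρ.toHom γ y) = π.toHom γ (T y) := by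
  refine ext_inner_left ℂ fun x => ?_
  have h := inner_toHom_left π γ⁻¹ x (T y)
  rw [inv_inv] at h
  rw [hT, ← h, hT, ← dual_toHom_dualVec]
  have h1 : x = π.toHom γ (π.toHom γ⁻¹ x) := by rw [← toHom_mul_apply]; simp
  conv_lhs => rw [h1, ← tensor_toHom_tvec, inner_toHom_left, hS γ⁻¹]

/-- Pair `S` with Y = Σ T eᵢ ⊗ eᵢ*: both this pairing and ‖Y‖² equal the sum in question, and
Cauchy–Schwarz gives the bound. Thus T is Hilbert–Schmidt. -/
theorem sum_norm_operator_sq_le {S : (π.tensor ρ.dual).H} {T : ρ.H →L[ℂ] π.H}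
    (hT : ∀ x y, inner ℂ x (T y) = inner ℂ (tvec π ρ.dual x (ρ.dualVec y)) S) (k : ℕ)
    (e : Fin k → ρ.H) (he : Orthonormal ℂ e) : ∑ i, ‖T (e i)‖ ^ 2 ≤ ‖S‖ ^ 2 := by
  set s : ℝ := ∑ i, ‖T (e i)‖ ^ 2 with hs
  have hs0 : 0 ≤ s := by positivity
  set Y : (π.tensor ρ.dual).H := ∑ i, tvec π ρ.dual (T (e i)) (ρ.dualVec (e i)) with hY
  have h1 : inner ℂ Y S = s := by
    rw [hY, sum_inner, hs, Complex.ofReal_sum]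
    refine Finset.sum_congr rfl fun i _ => ?_
    rw [← hT, inner_self_eq_norm_sq_to_K]; simp
  have h2 : ‖Y‖ ^ 2 = s := by
    rw [← inner_self_eq_norm_sq (𝕜 := ℂ), hY, sum_inner]
    simp only [inner_sum, inner_tvec, inner_dualVec, orthonormal_iff_ite.mp he]
    simp only [mul_ite, mul_one, mul_zero, Finset.sum_ite_eq',
      Finset.mem_univ, if_true, map_sum, inner_self_eq_norm_sq, hs]
  have h3 : s ≤ ‖Y‖ * ‖S‖ := by
    have := norm_inner_le_norm (𝕜 := ℂ) Y S
    rwa [h1, Complex.norm_real, Real.norm_of_nonneg hs0] at this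
  have h4 : s ^ 2 ≤ s * ‖S‖ ^ 2 := by
    calc s ^ 2 ≤ (‖Y‖ * ‖S‖) ^ 2 := by gcongr
      _ = s * ‖S‖ ^ 2 := by rw [mul_pow, h2]
  rcases hs0.eq_or_lt with h0 | h0
  · rw [← h0]; positivity
  · rw [sq] at h4; exact le_of_mul_le_mul_left h4 h0

/-! ### Almost invariant vectors of finite rank -/

/-- The vector of `π ⊗ ρ*` with coefficients `c` on the orbits of `x` and `y`. -/
noncomputable def tensorVec (π ρ : UnitaryRep.{u, w} Γ) (c : Γ × Γ →₀ ℂ) (x : π.H) (y : ρ.H) :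
    (π.tensor ρ.dual).H :=
  ∑ k ∈ c.support, c k • tvec π ρ.dual (π.toHom k.1 x) (ρ.dualVec (ρ.toHom k.2 y))

/-- Bounding by the operator norm of T instead of its Hilbert–Schmidt norm is what later controls
the dimension, by a quantity depending only on `c`. -/
theorem norm_inner_tensorVec_le {S : (π.tensor ρ.dual).H} {T : ρ.H →L[ℂ] π.H}
    (hT : ∀ x y, inner ℂ x (T y) = inner ℂ (tvec π ρ.dual x (ρ.dualVec y)) S)
    (c : Γ × Γ →₀ ℂ) {x : π.H} {y : ρ.H} (hx : ‖x‖ = 1) (hy : ‖y‖ = 1) :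
    ‖(inner ℂ (tensorVec π ρ c x y) S : ℂ)‖ ≤ (∑ k ∈ c.support, ‖c k‖) * ‖T‖ := by
  rw [tensorVec, sum_inner, Finset.sum_mul]
  refine norm_sum_le_of_le _ fun k _ => ?_
  rw [inner_smul_left, ← hT, norm_mul, RCLike.norm_conj]
  gcongr
  refine (norm_inner_le_norm _ _).trans ?_
  rw [LinearIsometryEquiv.norm_map, hx, one_mul]
  refine (T.le_opNorm _).trans_eq ?_
  rw [LinearIsometryEquiv.norm_map, hy, mul_one]

/-- If `π ⊗ π*` has a spectral gap, an almost invariant vector of finite rank yields a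
finite-dimensional invariant subspace of bounded dimension. -/
theorem exists_finiteDimensional_of_tensorVec {Q : Finset Γ} {ε : ℝ} (hε : 0 < ε)
    (hgap : HasGap Q ε (π.tensor π.dual)) (c : Γ × Γ →₀ ℂ) {v : π.H} (hv : ‖v‖ = 1)
    (hnorm : 1 / 2 < ‖tensorVec π π c v v‖ ^ 2)
    (hinv : ∑ γ ∈ Q, ‖(π.tensor π.dual).toHom γ (tensorVec π π c v v) - tensorVec π π c v v‖ ^ 2 <
      ε ^ 2 / 4 * ‖tensorVec π π c v v‖ ^ 2) :
    ∃ W : Submodule ℂ π.H, W ≠ ⊥ ∧ (∀ g, ∀ x ∈ W, π.toHom g x ∈ W) ∧ FiniteDimensional ℂ W ∧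
      (Module.finrank ℂ W : ℝ) ≤ 6 * (∑ k ∈ c.support, ‖c k‖) ^ 2 := by
  set X := tensorVec π π c v v with hX
  set L := ∑ k ∈ c.support, ‖c k‖ with hL
  obtain ⟨S, hS, horth, hdist⟩ := hgap.dist_invariants_le X
  -- The factor 1/4 in the hypothesis leaves ‖S‖² ≥ (3/4)‖X‖² > 3/8 for the invariant part.
  have hd : ‖X - S‖ ^ 2 ≤ ‖X‖ ^ 2 / 4 := by
    have h1 : ε ^ 2 * ‖X - S‖ ^ 2 ≤ ε ^ 2 * (‖X‖ ^ 2 / 4) := by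
      refine (hdist.trans hinv.le).trans_eq ?_; ring
    exact le_of_mul_le_mul_left h1 (by positivity)
  have hpyth : ‖X‖ ^ 2 = ‖S‖ ^ 2 + ‖X - S‖ ^ 2 := by
    have h1 : X = S + (X - S) := by abel
    have h2 := norm_add_sq (𝕜 := ℂ) S (X - S)
    rw [horth, ← h1] at h2
    simpa using h2
  have hS1 : 3 / 8 < ‖S‖ ^ 2 := by linarith
  have hXS : (inner ℂ X S : ℂ) = ((‖S‖ ^ 2 : ℝ) : ℂ) := by
    rw [inner_sub_right, sub_eq_zero] at horth
    rw [← inner_conj_symm, horth, inner_self_eq_norm_sq_to_K]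
    simp
  obtain ⟨T, hT⟩ := exists_operator S
  have hLT : ‖S‖ ^ 2 ≤ L * ‖T‖ := by
    have := norm_inner_tensorVec_le hT c hv hv
    rwa [← hX, hXS, Complex.norm_real, Real.norm_of_nonneg (by positivity)] at this
  have hT0 : T ≠ 0 := by
    rintro rfl
    rw [norm_zero, mul_zero] at hLT
    linarith
  obtain ⟨W, hW0, hW, hWf, hWd⟩ := exists_finiteDimensional_invariant π.toHom hT0
    (operator_comm hS hT) (sum_norm_operator_sq_le hT)
  refine ⟨W, hW0, hW, hWf, ?_⟩
  set d : ℝ := (Module.finrank ℂ W : ℝ)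
  have hd0 : 0 ≤ d := by positivity
  set s : ℝ := ‖S‖ ^ 2
  -- Combining s ≤ L‖T‖ with d‖T‖² ≤ 2s gives d s ≤ 2L²; since s > 3/8, this yields d ≤ (16/3)L²,
  -- which is rounded up to 6L².
  have h1 : d * s * s ≤ L ^ 2 * 2 * s := by
    calc d * s * s = d * s ^ 2 := by ring
      _ ≤ d * (L * ‖T‖) ^ 2 := by gcongr
      _ = L ^ 2 * (d * ‖T‖ ^ 2) := by ring
      _ ≤ L ^ 2 * (2 * s) := by gcongr
      _ = _ := by ring
  have h2 : d * s ≤ L ^ 2 * 2 := le_of_mul_le_mul_right h1 (by linarith)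
  nlinarith [mul_nonneg hd0 (sub_pos.mpr hS1).le, sq_nonneg L]

end UnitaryRep

namespace UnitaryRep

variable {Γ : Type u} [Group Γ]

/-! ### Traces of finite-dimensional subrepresentations -/

theorem orthogonal_invariant (π : UnitaryRep.{u, w} Γ) {W : Submodule ℂ π.H}
    (hW : ∀ g, ∀ x ∈ W, π.toHom g x ∈ W) (g : Γ) {x : π.H} (hx : x ∈ Wᗮ) :
    π.toHom g x ∈ Wᗮ := by
  rw [Submodule.mem_orthogonal] at hx ⊢
  intro y hy
  have h := inner_toHom_left π g⁻¹ y x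
  rw [inv_inv] at h
  rw [← h]
  exact hx _ (hW _ _ hy)

theorem starProjection_toHom (π : UnitaryRep.{u, w} Γ) {W : Submodule ℂ π.H}
    [W.HasOrthogonalProjection] (hW : ∀ g, ∀ x ∈ W, π.toHom g x ∈ W) (g : Γ) (x : π.H) :
    W.starProjection (π.toHom g x) = π.toHom g (W.starProjection x) := by
  refine Submodule.eq_starProjection_of_mem_orthogonal
    (hW g _ (W.starProjection_apply_mem x)) ?_
  rw [← map_sub]
  exact π.orthogonal_invariant hW g (W.sub_starProjection_mem_orthogonal x)

theorem quadForm_sum {ι : Type*} (s : Finset ι) (f : ι → Γ → ℂ) {n : ℕ} (g : Fin n → Γ)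
    (α : Fin n → ℂ) : quadForm (fun γ => ∑ i ∈ s, f i γ) g α = ∑ i ∈ s, quadForm (f i) g α := by
  classical
  induction s using Finset.induction_on with
  | empty => simp [quadForm]
  | insert i s hi ih =>
    simp only [Finset.sum_insert hi, ← ih]
    simpa using quadForm_add_smul (f i) (fun γ => ∑ i ∈ s, f i γ) 1 g α

theorem quadForm_coeff (π : UnitaryRep.{u, w} Γ) (x : π.H) {n : ℕ} (g : Fin n → Γ)
    (α : Fin n → ℂ) : quadForm (fun γ => inner ℂ x (π.toHom γ x)) g α =
      ((‖∑ i, α i • π.toHom (g i) x‖ ^ 2 : ℝ) : ℂ) := by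
  have := inner_self_eq_norm_sq_to_K (𝕜 := ℂ) (∑ i, α i • π.toHom (g i) x)
  rw [Complex.ofReal_pow]
  refine Eq.trans ?_ this
  simp only [sum_inner, inner_sum, inner_smul_left, inner_smul_right, quadForm, inner_toHom_left,
    toHom_mul_apply, Finset.mul_sum]
  refine Finset.sum_congr rfl fun i _ => Finset.sum_congr rfl fun j _ => ?_
  ring

/-- The vectors `x` whose translates are dominated by those of the cyclic vector `v`. -/
def dominated (π : UnitaryRep.{u, w} Γ) (v : π.H) : Submodule ℂ π.H where
  carrier := {x | ∃ C : ℝ, 0 ≤ C ∧ ∀ (n : ℕ) (g : Fin n → Γ) (α : Fin n → ℂ),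
    ‖∑ i, α i • π.toHom (g i) x‖ ≤ C * ‖∑ i, α i • π.toHom (g i) v‖}
  add_mem' := by
    rintro x y ⟨C, hC, hx⟩ ⟨D, hD, hy⟩
    refine ⟨C + D, by positivity, fun n g α => ?_⟩
    simp only [map_add, smul_add, Finset.sum_add_distrib, add_mul]
    exact (norm_add_le _ _).trans (add_le_add (hx n g α) (hy n g α))
  zero_mem' := ⟨0, le_rfl, fun n g α => by simp⟩
  smul_mem' := by
    rintro c x ⟨C, hC, hx⟩
    refine ⟨‖c‖ * C, by positivity, fun n g α => ?_⟩
    simp only [map_smul, smul_comm _ c, ← Finset.smul_sum, norm_smul, mul_assoc]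
    gcongr
    exact hx n g α

/-- The projection to `W` commutes with π, so it sends translates of `v` to vectors dominated by
right translates, hence by `v`. The dominated part of `W` is closed by finite dimension and contains
the image of a dense set. -/
theorem IsGNSVector.le_dominated {φ : Γ → ℂ} {π : UnitaryRep.{u, w} Γ} {v : π.H}
    (h : IsGNSVector φ π v) (hφ : φ ∈ traces Γ) {W : Submodule ℂ π.H} [FiniteDimensional ℂ W]
    (hW : ∀ g, ∀ x ∈ W, π.toHom g x ∈ W) : W ≤ π.dominated v := by
  set p : π.H →L[ℂ] π.H := W.starProjection with hp
  have hgen : ∀ k, p (π.toHom k v) ∈ π.dominated v := fun k => by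
    refine ⟨1, zero_le_one, fun n g α => ?_⟩
    have : ∑ i, α i • π.toHom (g i) (p (π.toHom k v)) =
        p (∑ i, α i • π.toHom (g i * k) v) := by
      simp only [map_sum, map_smul, hp, toHom_mul_apply, starProjection_toHom π hW]
    rw [this, one_mul, ← h.norm_sum_translate hφ g α k]
    exact W.norm_starProjection_apply_le _
  set V : Submodule ℂ π.H := W ⊓ π.dominated v
  have hVfin : FiniteDimensional ℂ V := Submodule.finiteDimensional_of_le inf_le_left
  have hVclosed : IsClosed (V : Set π.H) := V.closed_of_finiteDimensional
  have hall : ∀ x, p x ∈ V := by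
    intro x
    induction x using (denseRange_linearCombination h.1).induction_on with
    | hp => exact hVclosed.preimage p.continuous
    | ih a =>
      rw [Finsupp.linearCombination_apply, Finsupp.sum, map_sum]
      refine Submodule.sum_mem _ fun k _ => ?_
      rw [map_smul]
      exact Submodule.smul_mem _ _ ⟨W.starProjection_apply_mem _, hgen k⟩
  intro x hx
  have := (hall x).2
  rwa [hp, Submodule.starProjection_eq_self_iff.mpr hx] at this

/-- The linear representation underlying a unitary representation. -/
def linRep (σ : UnitaryRep.{u, w} Γ) : Representation ℂ Γ σ.H where
  toFun γ := (σ.toHom γ).toLinearEquiv.toLinearMap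
  map_one' := by ext x; exact σ.toHom_one_apply x
  map_mul' g k := by ext x; exact σ.toHom_mul_apply g k x

@[simp] theorem linRep_apply (σ : UnitaryRep.{u, w} Γ) (γ : Γ) (x : σ.H) :
    σ.linRep γ x = σ.toHom γ x := rfl

/-- The restriction of `π` to an invariant subspace. -/
noncomputable def subrep (π : UnitaryRep.{u, w} Γ) (W : Submodule ℂ π.H) [CompleteSpace W]
    (hW : ∀ g, ∀ x ∈ W, π.toHom g x ∈ W) : UnitaryRep.{u, w} Γ where
  H := W
  toHom :=
    { toFun := fun g =>
        { toFun := fun x => ⟨π.toHom g x, hW g x x.2⟩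
          invFun := fun x => ⟨π.toHom g⁻¹ x, hW g⁻¹ x x.2⟩
          map_add' := fun x y => by ext; simp
          map_smul' := fun c x => by ext; simp
          left_inv := fun x => by
            ext; change π.toHom g⁻¹ (π.toHom g x) = x; rw [← toHom_mul_apply]; simp
          right_inv := fun x => by
            ext; change π.toHom g (π.toHom g⁻¹ x) = x; rw [← toHom_mul_apply]; simp
          norm_map' := fun x => (π.toHom g).norm_map x }
      map_one' := by ext x; exact π.toHom_one_apply x
      map_mul' := fun g k => by ext x; exact π.toHom_mul_apply g k x }

/-- The character of `W` is conjugation-invariant and is a finite sum of coefficients dominated by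
φ; extremality makes it a multiple of φ. -/
theorem IsGNSVector.finrank_mul_eq {φ : Γ → ℂ} {π : UnitaryRep.{u, w} Γ} {v : π.H}
    (h : IsGNSVector φ π v) (hφ : φ ∈ characters Γ) {W : Submodule ℂ π.H} [FiniteDimensional ℂ W]
    (hW : ∀ g, ∀ x ∈ W, π.toHom g x ∈ W) (γ : Γ) :
    (π.subrep W hW).linRep.character γ = (Module.finrank ℂ W : ℂ) * φ γ := by
  set σ := π.subrep W hW with hσ
  let e := stdOrthonormalBasis ℂ W
  have htr : ∀ γ, σ.linRep.character γ = ∑ i, inner ℂ (e i : π.H) (π.toHom γ (e i)) := fun γ =>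
    LinearMap.trace_eq_sum_inner (E := W) (σ.linRep γ) e
  have hσf : FiniteDimensional ℂ σ.H := inferInstanceAs (FiniteDimensional ℂ W)
  have hone : σ.linRep.character 1 = (Module.finrank ℂ W : ℂ) := by
    rw [Representation.char_one]; rfl
  choose C hC hCle using fun i => h.le_dominated (extremePoints_subset hφ) hW (e i).2
  have hq : ∀ (n : ℕ) (g : Fin n → Γ) (α : Fin n → ℂ), quadForm σ.linRep.character g α =
      ((∑ i, ‖∑ j, α j • π.toHom (g j) (e i)‖ ^ 2 : ℝ) : ℂ) := by
    intro n g α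
    rw [Complex.ofReal_sum, show σ.linRep.character = _ from funext htr, quadForm_sum]
    simp only [quadForm_coeff]
  rw [← hone]
  refine eq_smul_of_dominated hφ (fun γ x => ?_) (C := ∑ i, C i ^ 2 + 1) (by positivity)
    (fun n g α => ?_) γ
  · rw [← σ.linRep.char_conj γ x⁻¹, inv_inv]
  · rw [hq, h.quadForm_eq, Complex.norm_real, Complex.ofReal_re,
      Real.norm_of_nonneg (by positivity), add_mul, Finset.sum_mul]
    refine le_add_of_le_of_nonneg (Finset.sum_le_sum fun i _ => ?_) (by positivity)
    rw [← mul_pow]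
    have := hCle i n g α
    gcongr

/-! ### Irreducible representations -/

/-- A minimal nonzero invariant subspace of a finite-dimensional one. -/
theorem exists_irreducible_le (π : UnitaryRep.{u, w} Γ) {W : Submodule ℂ π.H} (hW0 : W ≠ ⊥)
    (hW : ∀ g, ∀ x ∈ W, π.toHom g x ∈ W) (hfin : FiniteDimensional ℂ W) :
    ∃ (K : Submodule ℂ π.H) (_ : FiniteDimensional ℂ K)
      (hK : ∀ g, ∀ x ∈ K, π.toHom g x ∈ K), K ≤ W ∧ K ≠ ⊥ ∧
        (π.subrep K hK).linRep.IsIrreducible := by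
  induction hd : Module.finrank ℂ W using Nat.strong_induction_on generalizing W with
  | _ d ih =>
    by_cases hmin : ∀ V : Submodule ℂ π.H, V ≤ W → V ≠ ⊥ →
        (∀ g, ∀ x ∈ V, π.toHom g x ∈ V) → V = W
    · refine ⟨W, hfin, hW, le_rfl, hW0, ?_⟩
      have hnt : Nontrivial (π.subrep W hW).H := Submodule.nontrivial_iff_ne_bot.mpr hW0
      refine { exists_pair_ne := ⟨⊥, ⊤, fun h => ?_⟩, eq_bot_or_eq_top := fun U => ?_ }
      · exact bot_ne_top (congrArg Subrepresentation.toSubmodule h)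
      · by_cases hU : U.toSubmodule = ⊥
        · exact Or.inl (Subrepresentation.toSubmodule_injective hU)
        · right
          apply Subrepresentation.toSubmodule_injective
          let U' : Submodule ℂ W := U.toSubmodule
          have h1 := hmin (U'.map W.subtype) (Submodule.map_subtype_le W U')
            (fun h => hU (Submodule.map_injective_of_injective W.injective_subtype
              (h.trans (Submodule.map_bot _).symm))) (by
              rintro g _ ⟨x, hx, rfl⟩
              exact ⟨_, U.apply_mem_toSubmodule g hx, rfl⟩)
          have h2 : U' = ⊤ := by
            apply Submodule.map_injective_of_injective W.injective_subtype
            rw [h1, Submodule.map_subtype_top]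
          exact h2
    · push Not at hmin
      obtain ⟨V, hVW, hV0, hV, hne⟩ := hmin
      have hVf : FiniteDimensional ℂ V := Submodule.finiteDimensional_of_le hVW
      obtain ⟨K, hKf, hK, hKV, hK0, hirr⟩ := ih _
        (hd ▸ Submodule.finrank_lt_finrank_of_lt (lt_of_le_of_ne hVW hne)) hV0 hV hVf rfl
      exact ⟨K, hKf, hK, hKV.trans hVW, hK0, hirr⟩

end UnitaryRep

/-- Burnside's theorem. -/
theorem Representation.asAlgebraHom_surjective {k G V : Type*} [Field k] [IsAlgClosed k] [Monoid G]
    [AddCommGroup V] [Module k V] [FiniteDimensional k V] (ρ : Representation k G V)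
    [ρ.IsIrreducible] : Function.Surjective ρ.asAlgebraHom := by
  intro f
  have hfin : FiniteDimensional k ρ.asModule := inferInstance
  have hsimple : IsSimpleModule (MonoidAlgebra k G) ρ.asModule := inferInstance
  -- By Schur's lemma the commutant is scalar, so every linear map commutes with it; density then
  -- approximates the map exactly on a basis.
  have hbij := IsSimpleModule.algebraMap_end_bijective_of_isAlgClosed
    (A := MonoidAlgebra k G) (V := ρ.asModule) k
  let F : Module.End (Module.End (MonoidAlgebra k G) ρ.asModule) ρ.asModule :=
    { toFun := fun x => ρ.asModuleEquiv.symm (f (ρ.asModuleEquiv x))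
      map_add' := fun x y => by simp
      map_smul' := fun T x => by
        obtain ⟨c, rfl⟩ := hbij.2 T
        rw [RingHom.id_apply, Module.algebraMap_end_eq_smul_id]
        change ρ.asModuleEquiv.symm (f (ρ.asModuleEquiv (c • x))) =
          c • ρ.asModuleEquiv.symm (f (ρ.asModuleEquiv x))
        rw [map_smul, map_smul, map_smul] }
  let b := Module.finBasis k ρ.asModule
  obtain ⟨r, hr⟩ := jacobson_density F (Finset.univ.map ⟨b, b.injective⟩)
  refine ⟨r, ?_⟩
  refine (b.map ρ.asModuleEquiv).ext fun i => ?_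
  have := hr (b i) (by simp)
  rw [Module.Basis.map_apply, ← Representation.asModuleEquiv_map_smul, ← this]
  rfl

/-! ### Independence of matrix coefficients. -/

namespace UnitaryRep

variable {Γ : Type u} [Group Γ]

/-- By Burnside the relation extends from Γ to all endomorphisms; testing it on the rank-one map
taking `e p` to `y p` leaves ‖y p‖² = 0. -/
theorem eq_zero_of_irreducible {σ : UnitaryRep.{u, w} Γ} [FiniteDimensional ℂ σ.H]
    (hσ : σ.linRep.IsIrreducible) {ι : Type*} [Fintype ι] (e : OrthonormalBasis ι ℂ σ.H)
    (y : ι → σ.H) (h : ∀ γ, ∑ p, inner ℂ (y p) (σ.toHom γ (e p)) = 0) (p : ι) : y p = 0 := by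
  have hall : ∀ r, ∑ p, inner ℂ (y p) (σ.linRep.asAlgebraHom r (e p)) = 0 := by
    intro r
    induction r using MonoidAlgebra.induction_on with
    | of g => simpa [Representation.asAlgebraHom_of] using h g
    | add a b ha hb =>
      simp only [map_add, LinearMap.add_apply, inner_add_right, Finset.sum_add_distrib, ha, hb,
        add_zero]
    | smul c a ha =>
      simp only [map_smul, LinearMap.smul_apply, inner_smul_right, ← Finset.mul_sum, ha, mul_zero]
  obtain ⟨r, hr⟩ := σ.linRep.asAlgebraHom_surjective
    ((innerSL ℂ (e p)).toLinearMap.smulRight (y p))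
  have h1 := hall r
  classical
  rw [hr] at h1
  rw [Finset.sum_eq_single p (fun q _ hq => by
    simp [e.orthonormal.2 hq.symm]) (fun hp => absurd (Finset.mem_univ p) hp)] at h1
  simpa using h1

end UnitaryRep

namespace UnitaryRep

variable {Γ : Type u} [Group Γ]

/-! ### Exterior tensor products -/

theorem IsGNSVector.isSubrep {φ : Γ → ℂ} {π θ : UnitaryRep.{u, w} Γ} {v : π.H} {x : θ.H}
    (hx : IsGNSVector φ θ x) (hv : IsGNSVector φ π v) : IsSubrep θ π := by
  obtain ⟨V, hV⟩ := exists_linearIsometry_of_inner_eq (b := fun γ => π.toHom γ v) hx.1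
    (fun i j => by rw [hx.inner_eq, hv.inner_eq])
  refine ⟨V, fun γ y => ?_⟩
  have := eq_of_eq_on_family hx.1 (f := V.toContinuousLinearMap.comp
      (θ.toHom γ).toLinearIsometry.toContinuousLinearMap)
    (g := (π.toHom γ).toLinearIsometry.toContinuousLinearMap.comp V.toContinuousLinearMap)
    (fun k => by
      change V (θ.toHom γ (θ.toHom k x)) = π.toHom γ (V (θ.toHom k x))
      rw [← toHom_mul_apply, hV, hV, toHom_mul_apply])
  exact congr($this y)

theorem eq_zero_of_forall_inner_tvec {σ ρ : UnitaryRep.{u, w} Γ} {S : (σ.tensor ρ.dual).H}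
    (h : ∀ x y, inner ℂ (tvec σ ρ.dual x (ρ.dualVec y)) S = 0) : S = 0 := by
  refine eq_zero_of_inner_family_eq_zero (dense_span_tvec σ ρ.dual) fun p => ?_
  obtain ⟨y, hy⟩ := ρ.dualVec_surjective p.2
  rw [← hy, ← inner_conj_symm, h, map_zero]

/-- A unitary representation `Θ` of `Γ × Γ`, with a map `B`, is a model of the exterior tensor
product of `σ` and the dual of `τ`. -/
structure IsExtTensor (σ τ : UnitaryRep.{u, w} Γ) (Θ : UnitaryRep.{u, w} (Γ × Γ))
    (B : σ.H → τ.H → Θ.H) : Prop where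
  inner_eq : ∀ x y x' y', inner ℂ (B x y) (B x' y') = inner ℂ x x' * inner ℂ y' y
  toHom_eq : ∀ p x y, Θ.toHom p (B x y) = B (σ.toHom p.1 x) (τ.toHom p.2 y)
  eq_zero : ∀ S, (∀ x y, inner ℂ (B x y) S = 0) → S = 0
  exists_operator : ∀ S, ∃ T : τ.H →L[ℂ] σ.H, ∀ x y, inner ℂ x (T y) = inner ℂ (B x y) S

theorem exists_isExtTensor (σ τ : UnitaryRep.{u, w} Γ) : ∃ Θ B, IsExtTensor σ τ Θ B := by
  let σ' := σ.comp (MonoidHom.fst Γ Γ)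
  let τ' := τ.comp (MonoidHom.snd Γ Γ)
  refine ⟨σ'.tensor τ'.dual, fun x y => tvec σ' τ'.dual x (τ'.dualVec y), ?_, ?_, ?_, ?_⟩
  · intro x y x' y'
    exact (inner_tvec σ' τ'.dual _ _ _ _).trans (congrArg _ (inner_dualVec τ' _ _))
  · intro p x y
    exact (tensor_toHom_tvec σ' τ'.dual p _ _).trans
      (congrArg (tvec σ' τ'.dual _) (dual_toHom_dualVec τ' p _))
  · intro S hS
    exact eq_zero_of_forall_inner_tvec hS
  · intro S
    exact exists_operator S

theorem IsExtTensor.isSubrep_restrictDiag {σ τ : UnitaryRep.{u, w} Γ}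
    {Θ : UnitaryRep.{u, w} (Γ × Γ)} {B : σ.H → τ.H → Θ.H} (hB : IsExtTensor σ τ Θ B) :
    IsSubrep (σ.tensor τ.dual) Θ.restrictDiag := by
  choose y hy using τ.dualVec_surjective
  have hd := dense_span_tvec σ τ.dual
  have hin : ∀ p q, inner ℂ p q = inner ℂ (y q) (y p) := fun p q => by
    rw [← τ.inner_dualVec, hy, hy]
  obtain ⟨V, hV⟩ := exists_linearIsometry_of_inner_eq
    (b := fun p : σ.H × τ.dual.H => B p.1 (y p.2)) hd
    (fun i j => by rw [hB.inner_eq, inner_tvec, hin])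
  have hV' : ∀ a b, V (tvec σ τ.dual a (τ.dualVec b)) = B a b := fun a b => by
    have : y (τ.dualVec b) = b := (InnerProductSpace.toDual ℂ τ.H).injective (hy _)
    have h := hV (a, τ.dualVec b)
    rwa [this] at h
  refine ⟨V, fun γ z => ?_⟩
  have := eq_of_eq_on_family hd (f := V.toContinuousLinearMap.comp
      ((σ.tensor τ.dual).toHom γ).toLinearIsometry.toContinuousLinearMap)
    (g := (Θ.toHom (γ, γ)).toLinearIsometry.toContinuousLinearMap.comp V.toContinuousLinearMap)
    (fun p => by
      obtain ⟨b, hb⟩ := τ.dualVec_surjective p.2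
      change V ((σ.tensor τ.dual).toHom γ (tvec σ τ.dual p.1 p.2)) =
        Θ.toHom (γ, γ) (V (tvec σ τ.dual p.1 p.2))
      rw [← hb, tensor_toHom_tvec, dual_toHom_dualVec, hV', hV', hB.toHom_eq])
  exact congr($this z)

theorem trace_eq_sum {σ : UnitaryRep.{u, w} Γ} {ι : Type*} [Fintype ι]
    (e : OrthonormalBasis ι ℂ σ.H) (γ : Γ) :
    σ.linRep.character γ = ∑ i, inner ℂ (e i) (σ.toHom γ (e i)) :=
  LinearMap.trace_eq_sum_inner (σ.linRep γ) e

namespace IsExtTensor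

variable {σ τ : UnitaryRep.{u, w} Γ} {d : ℕ}
  {Θ : UnitaryRep.{u, w} (Γ × Γ)} {B : σ.H → τ.H → Θ.H}

theorem inner_sum (hB : IsExtTensor σ τ Θ B) (e : OrthonormalBasis (Fin d) ℂ σ.H)
    (f : OrthonormalBasis (Fin d) ℂ τ.H) (p : Γ × Γ) (c : ℂ) :
    inner ℂ (c • ∑ i, B (e i) (f i)) (Θ.toHom p (c • ∑ i, B (e i) (f i))) =
      (‖c‖ ^ 2 : ℝ) *
        ∑ i, ∑ j, inner ℂ (e i) (σ.toHom p.1 (e j)) * inner ℂ (τ.toHom p.2 (f j)) (f i) := by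
  rw [map_smul, inner_smul_left, inner_smul_right, ← mul_assoc, ← Complex.normSq_eq_conj_mul_self,
    Complex.normSq_eq_norm_sq]
  congr 1
  rw [map_sum, sum_inner]
  refine Finset.sum_congr rfl fun i _ => ?_
  rw [_root_.inner_sum]
  refine Finset.sum_congr rfl fun j _ => ?_
  rw [hB.toHom_eq, hB.inner_eq]

/-- Orthonormality of `f` collapses the coefficient to the trace of σ divided by d. The vector is
cyclic because a vector orthogonal to its orbit gives an operator T with Σ ⟨T fᵢ, σ(γ) eᵢ⟩ = 0, and
independence of matrix coefficients kills T. -/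
theorem isGNSVector_restrictLeft [FiniteDimensional ℂ σ.H] (hB : IsExtTensor σ τ Θ B)
    (e : OrthonormalBasis (Fin d) ℂ σ.H) (f : OrthonormalBasis (Fin d) ℂ τ.H)
    (hσ : σ.linRep.IsIrreducible) {φ : Γ → ℂ} (hφ : ∀ γ, σ.linRep.character γ = d * φ γ)
    {c : ℂ} (hc : ‖c‖ ^ 2 * d = 1) :
    IsGNSVector φ Θ.restrictLeft (c • ∑ i, B (e i) (f i)) := by
  have hc0 : c ≠ 0 := by rintro rfl; simp at hc
  have key : ∀ S : Θ.H, (∀ γ, inner ℂ (Θ.toHom (γ, 1) (c • ∑ i, B (e i) (f i))) S = 0) → S = 0 := by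
    intro S hS
    obtain ⟨T, hT⟩ := hB.exists_operator S
    have h0 : ∀ p, T (f p) = 0 := fun p =>
      eq_zero_of_irreducible hσ e (fun p => T (f p)) (fun γ => by
        have h := hS γ
        rw [map_smul, inner_smul_left, mul_eq_zero, map_eq_zero, or_iff_right hc0, map_sum,
          sum_inner] at h
        rw [← map_zero (starRingEnd ℂ), ← h, map_sum]
        refine Finset.sum_congr rfl fun i _ => ?_
        rw [hB.toHom_eq, ← hT, map_one, inner_conj_symm]
        rfl) p
    refine hB.eq_zero S fun x y => ?_
    have : T y = 0 := by
      rw [← f.sum_repr y, map_sum]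
      exact Finset.sum_eq_zero fun i _ => by rw [map_smul, h0, smul_zero]
    rw [← hT, this, inner_zero_right]
  refine ⟨?_, fun γ => ?_⟩
  · rw [Submodule.topologicalClosure_eq_top_iff, Submodule.eq_bot_iff]
    exact fun S hS => key S fun γ =>
      (Submodule.mem_orthogonal _ _).mp hS _ (Submodule.subset_span ⟨γ, rfl⟩)
  · refine Eq.trans ?_ (hB.inner_sum e f (γ, 1) c).symm
    have h1 : ((‖c‖ ^ 2 : ℝ) : ℂ) * d = 1 := by exact_mod_cast hc
    rw [← one_mul (φ γ), ← h1, mul_assoc, ← hφ, trace_eq_sum e]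
    simp [orthonormal_iff_ite.mp f.orthonormal]

/-- The mirror argument, with the adjoint of T in place of T; dualization conjugates the character.
-/
theorem isGNSVector_restrictRight [FiniteDimensional ℂ τ.H] (hB : IsExtTensor σ τ Θ B)
    (e : OrthonormalBasis (Fin d) ℂ σ.H) (f : OrthonormalBasis (Fin d) ℂ τ.H)
    (hτ : τ.linRep.IsIrreducible) {φ : Γ → ℂ} (hφ : ∀ γ, τ.linRep.character γ = d * φ γ)
    {c : ℂ} (hc : ‖c‖ ^ 2 * d = 1) :
    IsGNSVector (fun γ => (starRingEnd ℂ) (φ γ)) Θ.restrictRight (c • ∑ i, B (e i) (f i)) := by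
  have hc0 : c ≠ 0 := by rintro rfl; simp at hc
  have key : ∀ S : Θ.H, (∀ γ, inner ℂ (Θ.toHom (1, γ) (c • ∑ i, B (e i) (f i))) S = 0) → S = 0 := by
    intro S hS
    obtain ⟨T, hT⟩ := hB.exists_operator S
    have h0 : ∀ p, ContinuousLinearMap.adjoint T (e p) = 0 := fun p =>
      eq_zero_of_irreducible hτ f (fun p => ContinuousLinearMap.adjoint T (e p)) (fun γ => by
        have h := hS γ
        rw [map_smul, inner_smul_left, mul_eq_zero, map_eq_zero, or_iff_right hc0, map_sum,
          sum_inner] at h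
        rw [← h]
        refine Finset.sum_congr rfl fun i _ => ?_
        rw [hB.toHom_eq, ← hT, map_one, ContinuousLinearMap.adjoint_inner_left]
        rfl) p
    refine hB.eq_zero S fun x y => ?_
    have : ContinuousLinearMap.adjoint T x = 0 := by
      rw [← e.sum_repr x, map_sum]
      exact Finset.sum_eq_zero fun i _ => by rw [map_smul, h0, smul_zero]
    rw [← hT, ← ContinuousLinearMap.adjoint_inner_left, this, inner_zero_left]
  refine ⟨?_, fun γ => ?_⟩
  · rw [Submodule.topologicalClosure_eq_top_iff, Submodule.eq_bot_iff]
    exact fun S hS => key S fun γ =>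
      (Submodule.mem_orthogonal _ _).mp hS _ (Submodule.subset_span ⟨γ, rfl⟩)
  · refine Eq.trans ?_ (hB.inner_sum e f (1, γ) c).symm
    have h1 : ((‖c‖ ^ 2 : ℝ) : ℂ) * d = 1 := by exact_mod_cast hc
    have h2 : (d : ℂ) * (starRingEnd ℂ) (φ γ) = (starRingEnd ℂ) (τ.linRep.character γ) := by
      rw [hφ]; simp
    change (starRingEnd ℂ) (φ γ) = _
    rw [← one_mul ((starRingEnd ℂ) (φ γ)), ← h1, mul_assoc, h2, trace_eq_sum f]
    simp [orthonormal_iff_ite.mp e.orthonormal]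

end IsExtTensor

/-- A hereditary set need not contain multiples of its members. With equal dimensions, however, the
restrictions of the exterior product to the factors are exactly the GNS representations of φ and of
the conjugate of ψ. -/
theorem tensor_dual_mem_of_irreducible {R : Set (UnitaryRep.{u, w} Γ)} (hR : IsHereditary R)
    {π ρ : UnitaryRep.{u, w} Γ} (hπ : π ∈ R) (hρ : ρ ∈ R) {φ ψ : Γ → ℂ} {v : π.H} {w : ρ.H}
    (hv : IsGNSVector φ π v) (hw : IsGNSVector ψ ρ w) {σ τ : UnitaryRep.{u, w} Γ}
    [FiniteDimensional ℂ σ.H] [FiniteDimensional ℂ τ.H]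
    (hσ : σ.linRep.IsIrreducible) (hτ : τ.linRep.IsIrreducible) {d : ℕ} (hd : d ≠ 0)
    (e : OrthonormalBasis (Fin d) ℂ σ.H) (f : OrthonormalBasis (Fin d) ℂ τ.H)
    (hφ : ∀ γ, σ.linRep.character γ = d * φ γ) (hψ : ∀ γ, τ.linRep.character γ = d * ψ γ) :
    σ.tensor τ.dual ∈ R := by
  obtain ⟨Θ, B, hB⟩ := exists_isExtTensor σ τ
  have hc : ‖(((Real.sqrt d)⁻¹ : ℝ) : ℂ)‖ ^ 2 * d = 1 := by
    have : (d : ℝ) ≠ 0 := Nat.cast_ne_zero.mpr hd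
    rw [Complex.norm_real, Real.norm_eq_abs, sq_abs, inv_pow, Real.sq_sqrt (Nat.cast_nonneg d),
      inv_mul_cancel₀ this]
  refine hR.mem_of_isSubrep _ _ (hR.restrictDiag_mem Θ ?_ ?_) hB.isSubrep_restrictDiag
  · exact hR.mem_of_isSubrep _ _ hπ ((hB.isGNSVector_restrictLeft e f hσ hφ hc).isSubrep hv)
  · exact hR.mem_of_isSubrep _ _ (hR.dual_mem _ hρ)
      ((hB.isGNSVector_restrictRight e f hτ hψ hc).isSubrep hw.dual)

/-- Irreducible finite-dimensional unitary representations with a nonzero intertwiner between them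
have the same character. -/
theorem character_eq_of_intertwiner {σ τ : UnitaryRep.{u, w} Γ}
    [FiniteDimensional ℂ σ.H] [FiniteDimensional ℂ τ.H] (hτ : τ.linRep.IsIrreducible)
    (hfin : Module.finrank ℂ τ.H = Module.finrank ℂ σ.H) {T : τ.H →ₗ[ℂ] σ.H} (hT : T ≠ 0)
    (hcomm : ∀ γ y, T (τ.toHom γ y) = σ.toHom γ (T y)) (γ : Γ) :
    σ.linRep.character γ = τ.linRep.character γ := by
  -- Schur's lemma gives injectivity; equality of dimensions makes T an isomorphism.
  have hinj : Function.Injective T := by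
    let F : Representation.IntertwiningMap τ.linRep σ.linRep :=
      { T with isIntertwining' := fun γ => by ext y; exact hcomm γ y }
    refine (Representation.IsIrreducible.injective_or_eq_zero F).resolve_right fun h => hT ?_
    exact congrArg Representation.IntertwiningMap.toLinearMap h
  let E := LinearEquiv.ofInjectiveOfFinrankEq T hinj hfin
  have : σ.linRep γ = E.conj (τ.linRep γ) := by
    ext x
    obtain ⟨y, rfl⟩ := E.surjective x
    rw [LinearEquiv.conj_apply]
    simp
    exact (hcomm γ y).symm
  change LinearMap.trace ℂ _ (σ.linRep γ) = LinearMap.trace ℂ _ (τ.linRep γ)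
  rw [this, LinearMap.trace_conj']

end UnitaryRep

namespace UnitaryRep

variable {Γ : Type u} [Group Γ]

/-! ### Coefficients of vectors of finite rank -/

/-- The inner product of `tensorVec π ρ c x y` and its translate by `γ`, as a bilinear function of
the coefficients of `x` and `y`. -/
noncomputable def tensorForm (c : Γ × Γ →₀ ℂ) (γ : Γ) (φ ψ : Γ → ℂ) : ℂ :=
  ∑ k ∈ c.support, ∑ l ∈ c.support,
    (starRingEnd ℂ) (c k) * c l * (φ (k.1⁻¹ * (γ * l.1)) * ψ ((γ * l.2)⁻¹ * k.2))

theorem continuous_tensorForm (c : Γ × Γ →₀ ℂ) (γ : Γ) :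
    Continuous fun p : (Γ → ℂ) × (Γ → ℂ) => tensorForm c γ p.1 p.2 := by
  unfold tensorForm; fun_prop

theorem inner_tensorVec (π ρ : UnitaryRep.{u, w} Γ) (c : Γ × Γ →₀ ℂ) (γ : Γ) (x : π.H) (y : ρ.H) :
    inner ℂ (tensorVec π ρ c x y) ((π.tensor ρ.dual).toHom γ (tensorVec π ρ c x y)) =
      tensorForm c γ (fun g => inner ℂ x (π.toHom g x)) (fun g => inner ℂ y (ρ.toHom g y)) := by
  simp only [tensorVec, tensorForm, map_sum, map_smul, sum_inner, inner_sum, inner_smul_left,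
    inner_smul_right, tensor_toHom_tvec, dual_toHom_dualVec, inner_tvec, inner_dualVec]
  simp only [inner_toHom_left, toHom_mul_apply, mul_inv_rev, Finset.mul_sum]
  rw [Finset.sum_comm]
  refine Finset.sum_congr rfl fun k _ => Finset.sum_congr rfl fun l _ => ?_
  ring

theorem sum_tensorForm {ι κ : Type*} (s : Finset ι) (t : Finset κ) (c : Γ × Γ →₀ ℂ) (γ : Γ)
    (φ : ι → Γ → ℂ) (ψ : κ → Γ → ℂ) : ∑ i ∈ s, ∑ j ∈ t, tensorForm c γ (φ i) (ψ j) =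
      tensorForm c γ (fun g => ∑ i ∈ s, φ i g) (fun g => ∑ j ∈ t, ψ j g) := by
  have h : ∀ a b : ℂ, ∀ f : ι → ℂ, ∀ g : κ → ℂ, a * b * ((∑ i ∈ s, f i) * ∑ j ∈ t, g j) =
      ∑ i ∈ s, ∑ j ∈ t, a * b * (f i * g j) := fun a b f g => by
    rw [Finset.sum_mul_sum]; simp only [Finset.mul_sum]
  simp only [tensorForm, h]
  symm
  refine (Finset.sum_congr rfl fun k _ => Finset.sum_comm.trans
    (Finset.sum_congr rfl fun i _ => Finset.sum_comm)).trans ?_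
  exact Finset.sum_comm.trans (Finset.sum_congr rfl fun i _ => Finset.sum_comm)

theorem tensorForm_const_mul (c : Γ × Γ →₀ ℂ) (γ : Γ) (a b : ℂ) (φ ψ : Γ → ℂ) :
    tensorForm c γ (fun g => a * φ g) (fun g => b * ψ g) = a * b * tensorForm c γ φ ψ := by
  simp only [tensorForm, Finset.mul_sum]
  refine Finset.sum_congr rfl fun k _ => Finset.sum_congr rfl fun l _ => ?_
  ring

/-- The total displacement of a vector of finite rank under the elements of `Q`. -/
noncomputable def displacement (c : Γ × Γ →₀ ℂ) (Q : Finset Γ) (φ ψ : Γ → ℂ) : ℝ :=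
  ∑ γ ∈ Q, (2 * (tensorForm c 1 φ ψ).re - 2 * (tensorForm c γ φ ψ).re)

theorem norm_tensorVec_sq (π ρ : UnitaryRep.{u, w} Γ) (c : Γ × Γ →₀ ℂ) (x : π.H) (y : ρ.H) :
    ‖tensorVec π ρ c x y‖ ^ 2 = (tensorForm c 1 (fun g => inner ℂ x (π.toHom g x))
      (fun g => inner ℂ y (ρ.toHom g y))).re := by
  rw [← inner_tensorVec, toHom_one_apply, ← inner_self_eq_norm_sq (𝕜 := ℂ)]; rfl

theorem sum_norm_tensorVec_sub_sq (π ρ : UnitaryRep.{u, w} Γ) (c : Γ × Γ →₀ ℂ) (Q : Finset Γ)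
    (x : π.H) (y : ρ.H) :
    ∑ γ ∈ Q, ‖(π.tensor ρ.dual).toHom γ (tensorVec π ρ c x y) - tensorVec π ρ c x y‖ ^ 2 =
      displacement c Q (fun g => inner ℂ x (π.toHom g x)) (fun g => inner ℂ y (ρ.toHom g y)) := by
  refine Finset.sum_congr rfl fun γ _ => ?_
  rw [norm_toHom_sub_sq, norm_tensorVec_sq, inner_tensorVec]

theorem displacement_const_mul (c : Γ × Γ →₀ ℂ) (Q : Finset Γ) (a b : ℝ) (φ ψ : Γ → ℂ) :
    displacement c Q (fun g => a * φ g) (fun g => b * ψ g) = a * b * displacement c Q φ ψ := by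
  simp only [displacement, tensorForm_const_mul, Finset.mul_sum, ← Complex.ofReal_mul,
    Complex.re_ofReal_mul]
  exact Finset.sum_congr rfl fun _ _ => by ring

theorem continuous_displacement (c : Γ × Γ →₀ ℂ) (Q : Finset Γ) :
    Continuous fun p : (Γ → ℂ) × (Γ → ℂ) => displacement c Q p.1 p.2 := by
  have := continuous_tensorForm (Γ := Γ) c
  unfold displacement; fun_prop

/-- The translates of a cyclic vector by `Γ × Γ` span a dense subspace of `π ⊗ ρ*`. -/
theorem denseRange_tensorVec {π ρ : UnitaryRep.{u, w} Γ} {v : π.H} {y : ρ.H}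
    (hv : (Submodule.span ℂ (Set.range fun γ => π.toHom γ v)).topologicalClosure = ⊤)
    (hy : (Submodule.span ℂ (Set.range fun γ => ρ.toHom γ y)).topologicalClosure = ⊤) :
    DenseRange fun c => tensorVec π ρ c v y := by
  have hd : (Submodule.span ℂ (Set.range fun k : Γ × Γ =>
      tvec π ρ.dual (π.toHom k.1 v) (ρ.dualVec (ρ.toHom k.2 y)))).topologicalClosure = ⊤ := by
    rw [Submodule.topologicalClosure_eq_top_iff, Submodule.eq_bot_iff]
    intro S hS
    obtain ⟨T, hT⟩ := exists_operator S
    have hT0 : T = 0 := by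
      refine eq_of_eq_on_family hy fun γ => ?_
      refine eq_zero_of_inner_family_eq_zero hv fun g => ?_
      rw [← inner_conj_symm, hT, (Submodule.mem_orthogonal _ _).mp hS _
        (Submodule.subset_span ⟨(g, γ), rfl⟩), map_zero]
    refine eq_zero_of_forall_inner_tvec fun a b => ?_
    rw [← hT, hT0]
    simp
  exact denseRange_linearCombination hd

/-- Approximation by a finite combination of translates turns almost invariance into strict
inequalities between finitely many values of ψ, an open condition. -/
theorem HasAlmostInvariantVectors.exists_tensorForm {ψ : Γ → ℂ} {π : UnitaryRep.{u, w} Γ} {v : π.H}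
    (hv : IsGNSVector ψ π v) (h : (π.tensor π.dual).HasAlmostInvariantVectors) (Q : Finset Γ)
    {δ : ℝ} (hδ : 0 < δ) : ∃ c : Γ × Γ →₀ ℂ, 1 / 2 < (tensorForm c 1 ψ ψ).re ∧
      displacement c Q ψ ψ < δ * (tensorForm c 1 ψ ψ).re := by
  -- An s-approximation of an s-invariant unit vector is moved by at most 3s; s < 1/4 keeps its norm
  -- above 3/4 and the square above 1/2.
  obtain ⟨s, hs, hs4, hs0⟩ : ∃ s : ℝ,
      (Q.card : ℝ) * (3 * s) ^ 2 < δ * (1 / 2) ∧ s < 1 / 4 ∧ 0 < s := by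
    have h1 : Filter.Tendsto (fun s : ℝ => (Q.card : ℝ) * (3 * s) ^ 2) (𝓝[>] 0)
        (𝓝 ((Q.card : ℝ) * (3 * 0) ^ 2)) :=
      (Continuous.tendsto (by fun_prop) 0).mono_left nhdsWithin_le_nhds
    have h2 : (Q.card : ℝ) * (3 * (0 : ℝ)) ^ 2 < δ * (1 / 2) := by simpa using hδ
    exact ((h1.eventually_lt_const h2).and (((eventually_lt_nhds (by norm_num)).filter_mono
      nhdsWithin_le_nhds).and self_mem_nhdsWithin)).exists
  obtain ⟨x, hx, hxQ⟩ := h Q s hs0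
  obtain ⟨c, hc⟩ := (denseRange_tensorVec hv.1 hv.1).exists_dist_lt x hs0
  have hψ : (fun g => inner ℂ v (π.toHom g v)) = ψ := funext fun g => (hv.2 g).symm
  have e1 := norm_tensorVec_sq π π c v v
  have e2 := sum_norm_tensorVec_sub_sq π π c Q v v
  rw [hψ] at e1 e2
  set X := tensorVec π π c v v
  rw [dist_eq_norm] at hc
  have hX : 3 / 4 < ‖X‖ := by
    have := norm_sub_norm_le x X
    rw [hx] at this; linarith
  have hX2 : 1 / 2 < ‖X‖ ^ 2 := by nlinarith
  refine ⟨c, e1 ▸ hX2, ?_⟩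
  rw [← e1, ← e2]
  refine lt_of_le_of_lt ?_ (hs.trans_le (by gcongr))
  rw [← nsmul_eq_mul]
  refine Finset.sum_le_card_nsmul _ _ _ fun γ hγ => ?_
  gcongr
  have h1 : (π.tensor π.dual).toHom γ X - X =
      ((π.tensor π.dual).toHom γ x - x) - (π.tensor π.dual).toHom γ (x - X) + (x - X) := by
    rw [map_sub]; abel
  rw [h1]
  refine (norm_add_le _ _).trans ((add_le_add_left (norm_sub_le _ _) _).trans ?_)
  rw [LinearIsometryEquiv.norm_map]
  linarith [hxQ γ hγ]

/-- If `σ ⊗ τ*` has a spectral gap and vectors with small displacement on average, then it has a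
nonzero invariant vector, i.e. an intertwiner from `τ` to `σ`. -/
theorem exists_intertwiner {σ τ : UnitaryRep.{u, w} Γ} [FiniteDimensional ℂ σ.H]
    [FiniteDimensional ℂ τ.H] {Q : Finset Γ} {ε : ℝ} (hgap : HasGap Q ε (σ.tensor τ.dual))
    (c : Γ × Γ →₀ ℂ) (hlt : displacement c Q σ.linRep.character τ.linRep.character <
      ε ^ 2 * (tensorForm c 1 σ.linRep.character τ.linRep.character).re) :
    ∃ T : τ.H →L[ℂ] σ.H, T ≠ 0 ∧ ∀ γ y, T (τ.toHom γ y) = σ.toHom γ (T y) := by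
  have hne : (σ.tensor τ.dual).invariants ≠ ⊥ := by
    intro hbot
    let e := stdOrthonormalBasis ℂ σ.H
    let f := stdOrthonormalBasis ℂ τ.H
    have hσ : σ.linRep.character = fun g => ∑ i, inner ℂ (e i) (σ.toHom g (e i)) :=
      funext fun g => trace_eq_sum e g
    have hτ : τ.linRep.character = fun g => ∑ i, inner ℂ (f i) (τ.toHom g (f i)) :=
      funext fun g => trace_eq_sum f g
    -- Without invariant vectors the gap holds for every vector. Summed over both bases,
    -- coefficients become characters and the hypothesis is contradicted.
    have hall : ∀ i j, ε ^ 2 * ‖tensorVec σ τ c (e i) (f j)‖ ^ 2 ≤ ∑ γ ∈ Q,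
        ‖(σ.tensor τ.dual).toHom γ (tensorVec σ τ c (e i) (f j)) -
          tensorVec σ τ c (e i) (f j)‖ ^ 2 := fun i j => hgap _ (by rw [hbot]; simp)
    refine hlt.not_ge ?_
    have h1 : ε ^ 2 * (tensorForm c 1 σ.linRep.character τ.linRep.character).re =
        ∑ i, ∑ j, ε ^ 2 * ‖tensorVec σ τ c (e i) (f j)‖ ^ 2 := by
      simp only [hσ, hτ, ← sum_tensorForm, Complex.re_sum, norm_tensorVec_sq, Finset.mul_sum]
    have h2 : displacement c Q σ.linRep.character τ.linRep.character = ∑ i, ∑ j, ∑ γ ∈ Q,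
        ‖(σ.tensor τ.dual).toHom γ (tensorVec σ τ c (e i) (f j)) -
          tensorVec σ τ c (e i) (f j)‖ ^ 2 := by
      simp only [sum_norm_tensorVec_sub_sq]
      simp only [displacement, hσ, hτ, ← sum_tensorForm, Complex.re_sum, Finset.mul_sum,
        ← Finset.sum_sub_distrib]
      rw [Finset.sum_comm]
      refine Finset.sum_congr rfl fun i _ => ?_
      rw [Finset.sum_comm]
    rw [h1, h2]
    exact Finset.sum_le_sum fun i _ => Finset.sum_le_sum fun j _ => hall i j
  obtain ⟨S, hS, hS0⟩ := Submodule.exists_mem_ne_zero_of_ne_bot hne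
  obtain ⟨T, hT⟩ := exists_operator S
  refine ⟨T, ?_, operator_comm hS hT⟩
  rintro rfl
  exact hS0 (eq_zero_of_forall_inner_tvec fun x y => by rw [← hT]; simp)

end UnitaryRep

namespace UnitaryRep

variable {Γ : Type u} [Group Γ]

/-! ### Accumulation points of characters -/

theorem exists_irreducible_of_displacement {R : Set (UnitaryRep.{u, w} Γ)} (hR : IsHereditary R)
    {Q : Finset Γ} {ε : ℝ} (hε : 0 < ε) (hgap : ∀ π ∈ R, HasGap Q ε π) {φ : Γ → ℂ}
    (hφ : φ ∈ charactersIn R) (c : Γ × Γ →₀ ℂ) (hnorm : 1 / 2 < (tensorForm c 1 φ φ).re)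
    (hlt : displacement c Q φ φ < ε ^ 2 / 4 * (tensorForm c 1 φ φ).re) :
    ∃ (σ : UnitaryRep.{u, w} Γ) (_ : FiniteDimensional ℂ σ.H), σ.linRep.IsIrreducible ∧
      Module.finrank ℂ σ.H ≠ 0 ∧ (Module.finrank ℂ σ.H : ℝ) ≤ 6 * (∑ k ∈ c.support, ‖c k‖) ^ 2 ∧
      ∀ γ, σ.linRep.character γ = Module.finrank ℂ σ.H * φ γ := by
  obtain ⟨hφc, π, hπ, v, hv⟩ := hφ
  have hv : IsGNSVector φ π v := hv
  have hcoeff : (fun g => inner ℂ v (π.toHom g v)) = φ := funext fun g => (hv.2 g).symm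
  obtain ⟨W, hW0, hW, hWf, hWd⟩ := exists_finiteDimensional_of_tensorVec hε
    (hgap _ (hR.tensor_dual_mem _ hπ)) c (hv.norm_eq_one (extremePoints_subset hφc))
    (by rwa [norm_tensorVec_sq, hcoeff])
    (by rwa [sum_norm_tensorVec_sub_sq, norm_tensorVec_sq, hcoeff])
  obtain ⟨K, hKf, hK, hKW, hK0, hirr⟩ := exists_irreducible_le π hW0 hW hWf
  refine ⟨π.subrep K hK, hKf, hirr, ?_, ?_, hv.finrank_mul_eq hφc hK⟩
  · exact fun h => hK0 (Submodule.finrank_eq_zero.mp h)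
  · have : Module.finrank ℂ K ≤ Module.finrank ℂ W := Submodule.finrank_mono hKW
    exact le_trans (by exact_mod_cast this) hWd

/-- Multiplication by d² replaces φ and ψ by the characters of σ and τ, and the gap of σ ⊗ τ* then
produces an intertwiner. -/
theorem eq_of_displacement_lt {R : Set (UnitaryRep.{u, w} Γ)} (hR : IsHereditary R)
    {Q : Finset Γ} {ε : ℝ} (hgap : ∀ π ∈ R, HasGap Q ε π) {φ ψ : Γ → ℂ}
    (hφ : φ ∈ charactersIn R) (hψ : ψ ∈ charactersIn R) {σ τ : UnitaryRep.{u, w} Γ}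
    [FiniteDimensional ℂ σ.H] [FiniteDimensional ℂ τ.H]
    (hσ : σ.linRep.IsIrreducible) (hτ : τ.linRep.IsIrreducible)
    (hfin : Module.finrank ℂ σ.H = Module.finrank ℂ τ.H) (h0 : Module.finrank ℂ σ.H ≠ 0)
    (hφσ : ∀ γ, σ.linRep.character γ = Module.finrank ℂ σ.H * φ γ)
    (hψτ : ∀ γ, τ.linRep.character γ = Module.finrank ℂ τ.H * ψ γ) (c : Γ × Γ →₀ ℂ)
    (hlt : displacement c Q φ ψ < ε ^ 2 * (tensorForm c 1 φ ψ).re) : φ = ψ := by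
  obtain ⟨-, π, hπ, v, hv⟩ := hφ
  obtain ⟨-, ρ, hρ, w, hw⟩ := hψ
  rw [← hfin] at hψτ
  set d := Module.finrank ℂ σ.H
  have hmem := tensor_dual_mem_of_irreducible hR hπ hρ hv hw hσ hτ h0
    (stdOrthonormalBasis ℂ σ.H) ((stdOrthonormalBasis ℂ τ.H).reindex (finCongr hfin.symm)) hφσ hψτ
  have hd : (0 : ℝ) < d := Nat.cast_pos.mpr (Nat.pos_of_ne_zero h0)
  have e1 : σ.linRep.character = fun γ => ((d : ℝ) : ℂ) * φ γ := funext fun γ => by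
    rw [hφσ]; simp
  have e2 : τ.linRep.character = fun γ => ((d : ℝ) : ℂ) * ψ γ := funext fun γ => by
    rw [hψτ]; simp
  obtain ⟨T, hT, hcomm⟩ := exists_intertwiner (hgap _ hmem) c (by
    rw [e1, e2, displacement_const_mul, tensorForm_const_mul, ← Complex.ofReal_mul,
      Complex.re_ofReal_mul]
    calc (d : ℝ) * d * displacement c Q φ ψ
        < d * d * (ε ^ 2 * (tensorForm c 1 φ ψ).re) := by gcongr
      _ = _ := by ring)
  funext γ
  have h := character_eq_of_intertwiner hτ hfin.symm (T := (T : τ.H →ₗ[ℂ] σ.H))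
    (fun h => hT (ContinuousLinearMap.coe_injective h)) hcomm γ
  rw [hφσ, hψτ] at h
  exact mul_left_cancel₀ (Nat.cast_ne_zero.mpr h0) h

theorem not_mapClusterPt_of_amenable {R : Set (UnitaryRep.{u, w} Γ)} (hR : IsHereditary R)
    {Q : Finset Γ} {ε : ℝ} (hε : 0 < ε) (hgap : ∀ π ∈ R, HasGap Q ε π) {φ : ℕ → Γ → ℂ}
    (hφ : ∀ n, φ n ∈ charactersIn R) (hinj : Function.Injective φ) {ψ : Γ → ℂ}
    (hψ : IsAmenableTrace.{u, w} ψ) : ¬ MapClusterPt ψ Filter.atTop φ := by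
  intro hcl
  obtain ⟨π, ⟨v, hv⟩, hai⟩ := hψ
  obtain ⟨c, hc1, hc2⟩ := hai.exists_tensorForm hv Q (δ := ε ^ 2 / 4) (by positivity)
  have hre : Continuous fun p : (Γ → ℂ) × (Γ → ℂ) => (tensorForm c 1 p.1 p.2).re :=
    Complex.continuous_re.comp (continuous_tensorForm c 1)
  have hev : ∀ᶠ p : (Γ → ℂ) × (Γ → ℂ) in 𝓝 ψ ×ˢ 𝓝 ψ, 1 / 2 < (tensorForm c 1 p.1 p.2).re ∧
      displacement c Q p.1 p.2 < ε ^ 2 / 4 * (tensorForm c 1 p.1 p.2).re := by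
    rw [← nhds_prod_eq]
    -- The inequalities are taken for pairs near (ψ, ψ): the diagonal pairs bound dimensions, the
    -- off-diagonal ones compare two characters using the same `c`.
    exact ((isOpen_lt continuous_const hre).inter
      (isOpen_lt (continuous_displacement c Q) (by fun_prop))).mem_nhds ⟨hc1, hc2⟩
  obtain ⟨U, hU, hUU⟩ := (Filter.eventually_prod_self_iff
    (r := fun a b => 1 / 2 < (tensorForm c 1 a b).re ∧
      displacement c Q a b < ε ^ 2 / 4 * (tensorForm c 1 a b).re)).mp hev
  have hinf : {n | φ n ∈ U}.Infinite :=
    Nat.frequently_atTop_iff_infinite.mp (hcl.frequently hU)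
  have hex : ∀ n, φ n ∈ U → _ := fun n hn =>
    exists_irreducible_of_displacement hR hε hgap (hφ n) c (hUU _ hn _ hn).1 (hUU _ hn _ hn).2
  have : Nonempty (UnitaryRep.{u, w} Γ) := ⟨trivial Γ⟩
  choose! σ hσf hσ h0 hle hχ using hex
  -- Pigeonhole: the dimensions are bounded in terms of `c` alone, while infinitely many indices are
  -- available.
  obtain ⟨n, hn, m, hm, hne, hnm⟩ := hinf.exists_ne_map_eq_of_mapsTo
    (f := fun n => Module.finrank ℂ (σ n).H)
    (fun n hn => Set.mem_Iic.mpr (Nat.le_floor (hle n hn))) (Set.finite_Iic _)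
  have := hσf n hn
  have := hσf m hm
  refine hne (hinj (eq_of_displacement_lt hR hgap (hφ n) (hφ m) (hσ n hn) (hσ m hm) hnm (h0 n hn)
    (hχ n hn) (hχ m hm) c ?_))
  obtain ⟨h1, h2⟩ := hUU _ hn _ hm
  refine h2.trans_le ?_
  have : 0 < ε ^ 2 := by positivity
  gcongr
  linarith

end UnitaryRep

/-! ### Conclusion by compactness. -/

theorem norm_le_one_of_isGNS {Γ : Type u} [Group Γ] {φ : Γ → ℂ} (hφ : φ ∈ traces Γ)
    {π : UnitaryRep.{u, w} Γ} (h : IsGNS φ π) (γ : Γ) : ‖φ γ‖ ≤ 1 := by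
  obtain ⟨v, hv⟩ := h
  have hv1 : ‖v‖ = 1 := UnitaryRep.IsGNSVector.norm_eq_one hv hφ
  rw [hv.2]
  refine (norm_inner_le_norm _ _).trans ?_
  rw [LinearIsometryEquiv.norm_map, hv1, one_mul]

theorem mainTheorem6 {Γ : Type u} [Group Γ] [Countable Γ] (N : Subgroup Γ) [N.Normal]
    (R : Set (UnitaryRep.{u, w} Γ)) (hR : UnitaryRep.IsHereditary R)
    (hT : UnitaryRep.PropertyT R)
    (hdich : ∀ φ ∈ characters Γ, IsAmenableTrace.{u, w} φ ∨ ∀ γ ∉ N, φ γ = 0)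
    (φ : ℕ → Γ → ℂ) (hφ : ∀ n, φ n ∈ charactersIn R) (hinj : Function.Injective φ) :
    (∀ ψ : Γ → ℂ, MapClusterPt ψ Filter.atTop φ → ψ ∈ characters Γ ∧ ∀ γ ∉ N, ψ γ = 0) ∧
      ∀ γ ∉ N, Filter.Tendsto (fun n => φ n γ) Filter.atTop (nhds 0) := by
  obtain ⟨Q, ε, hε, hgap⟩ := hT.exists_hasGap
  have htr : ∀ n, φ n ∈ traces Γ := fun n => extremePoints_subset (hφ n).1
  have hconj : ∀ n, UnitaryRep.ConjGap Q ε (φ n) := fun n => by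
    obtain ⟨hn, π, hπ, v, hv⟩ := hφ n
    obtain ⟨c, hc, hcR⟩ := UnitaryRep.IsGNSVector.exists_conj_mem hR hv (htr n) hπ
    exact UnitaryRep.IsGNSVector.conjGap hv hn hc (hgap _ hcR)
  have hmain : ∀ ψ : Γ → ℂ, MapClusterPt ψ Filter.atTop φ →
      ψ ∈ characters Γ ∧ ∀ γ ∉ N, ψ γ = 0 := fun ψ hψ => by
    have hch : ψ ∈ characters Γ := UnitaryRep.ConjGap.mem_characters
      ((isClosed_traces Γ).mem_of_mapClusterPt hψ (.of_forall htr)) hε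
      ((UnitaryRep.isClosed_conjGap Q ε).mem_of_mapClusterPt hψ (.of_forall hconj))
    exact ⟨hch, (hdich ψ hch).resolve_left fun ham =>
      UnitaryRep.not_mapClusterPt_of_amenable hR hε hgap hφ hinj ham hψ⟩
  refine ⟨hmain, fun γ hγ => ?_⟩
  by_contra hnot
  rw [Metric.tendsto_nhds] at hnot
  push Not at hnot
  obtain ⟨δ, hδ, hfr⟩ := hnot
  have hcpt : IsCompact (Set.univ.pi fun _ : Γ => Metric.closedBall (0 : ℂ) 1) :=
    isCompact_univ_pi fun _ => isCompact_closedBall _ _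
  have hmem : ∀ n, φ n ∈ Set.univ.pi fun _ : Γ => Metric.closedBall (0 : ℂ) 1 := fun n g _ => by
    obtain ⟨-, π, -, hπ⟩ := hφ n
    simpa using norm_le_one_of_isGNS (htr n) hπ g
  -- Restricting to the indices where φ_n(γ) stays at distance at least δ from 0, compactness gives
  -- a cluster point of the whole sequence with |ψ(γ)| ≥ δ, although ψ must vanish at γ.
  set F : Filter ℕ := Filter.atTop ⊓ Filter.principal {n | ¬ dist (φ n γ) 0 < δ}
  have hF : F.NeBot := Filter.frequently_mem_iff_neBot.mp (hfr.mono fun n h => by simpa using h)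
  obtain ⟨ψ, -, hψ⟩ := hcpt.exists_mapClusterPt (f := F) (u := φ)
    (Filter.tendsto_principal.mpr (Filter.Eventually.of_forall hmem))
  have h1 : ψ γ = 0 := (hmain ψ (hψ.mono inf_le_left)).2 γ hγ
  have h2 : IsClosed {χ : Γ → ℂ | δ ≤ ‖χ γ‖} := isClosed_le continuous_const (by fun_prop)
  have h3 := h2.mem_of_mapClusterPt hψ
    (Filter.mem_inf_of_right (by simp [Filter.mem_principal]))
  rw [Set.mem_ofPred_eq, h1, norm_zero] at h3
  linarith
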